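/- **Definitions.** A *cartesian left-additive category* is a symmetric monoidal category in which every object $A$ carries a commutative comonoid (copy $A\to A\otimes A$, discard $A\to I$), natural in all morphisms and coherent with $\otimes$ (that is, a cartesian category), and a commutative monoid $(+_A\colon A\otimes A\to A,\ 0_A\colon I\to A)$ coherent with $\otimes$. We write composites in terms of generalized elements, and write $0$ for a zero morphism (discard, then zero). A *reverse derivative category* is a cartesian left-additive category with an operator $\mathsf R$ sending each $f\colon A\to B$ to $\mathsf R[f]\colon A\otimes B\to A$ such that * [ARD.1] $\mathsf R[\mathrm{id}_A](a,a')=a'$; $\mathsf R[\mathrm{swap}_{A,B}]((a,b),(b',a'))=(a',b')$; $\mathsf R[\mathrm{copy}_A](a,(a_1,a_2))=a_1+a_2$; $\mathsf R[\mathrm{discard}_A](a,*)=0$; $\mathsf R[+_A]((a_1,a_2),a')=(a',a')$; $\mathsf R[0_A]=\mathrm{discard}$; for $f\colon A\to B$, $g\colon B\to C$, $\mathsf R[f;g](a,c)=\mathsf R[f](a,\mathsf R[g](f(a),c))$; and $\mathsf R[f\otimes g]((a,a'),(b,b'))=(\mathsf R[f](a,b),\mathsf R[g](a',b'))$; * [ARD.2]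 $\mathsf R[f](a,b+b')=\mathsf R[f](a,b)+\mathsf R[f](a,b')$ and $\mathsf R[f](a,0)=0$; * [ARD.3] $\mathsf D_B[\mathsf R[f]](a,(b,b'))=\mathsf R[f](a,b')$; * [ARD.4] $\mathsf D[\mathsf D[f]]((a,b),(c,d))=\mathsf D[\mathsf D[f]]((a,c),(b,d))$. Here, for $f\colon A\to B$, $\mathsf D[f](a,a')=\pi_B\big(\mathsf R[\mathsf R[f]]((a,0),a')\big)$, and for $g\colon A\otimes B\to X$, $\mathsf D_B[g](a,(b,b'))=\mathsf D[g]((a,b),(0,b'))$. Given a set $\mathrm{Obj}$ and a set $\Sigma$ of generating morphisms $s\colon w\to v$ between words $w,v\in\mathrm{Obj}^\star$, *$\Sigma$-terms* are built from the generators, identities, symmetries, the copy, discard, addition and zero maps of each $A\in\mathrm{Obj}$, by composition $f;g$ and tensor $f\otimes h$. For a set $E$ of equations between parallel $\Sigma$-terms, the cartesian left-additive category $\mathcal C$ *presented by* $(\mathrm{Obj},\Sigma)$ and $E$ has $\mathrm{Obj}^\star$ as objects, concatenation as (strict) monoidal product, and as morphisms the $\Sigma$-terms modulo the laws of cartesian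 left-additive categories and $E$. **Theorem.** Let $\mathcal C$ be the cartesian left-additive category presented by generators $(\mathrm{Obj},\Sigma)$ and equations $E$. Assign to each generator $s\colon w\to v$ in $\Sigma$ a $\Sigma$-term $\mathsf R[s]\colon wv\to w$, and extend $\mathsf R$ to all $\Sigma$-terms by the formulas of ARD.1. Suppose that 1. $\mathsf R$ is well defined with respect to $E$: for each equation $f=g$ in $E$, the terms $\mathsf R[f]$ and $\mathsf R[g]$ represent the same morphism of $\mathcal C$; 2. each $s\in\Sigma$ satisfies ARD.2, ARD.3 and ARD.4, as equations between morphisms of $\mathcal C$ (with $\mathsf D$ and the iterates of $\mathsf R$ computed on terms). Then $\mathsf R$ descends to an operator on the morphisms of $\mathcal C$, and with this operator $\mathcal C$ is a reverse derivative category. -/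

import Mathlib

open CategoryTheory MonoidalCategory CartesianMonoidalCategory

universe u v

/-! ### Cartesian left-additive categories and reverse derivative categories -/

/-- A cartesian left-additive category: a cartesian (symmetric monoidal) category in which each
object carries a commutative monoid, coherently with the monoidal product. Copy is
`lift (𝟙 A) (𝟙 A) : A ⟶ A ⊗ A` and discard is `toUnit A : A ⟶ 𝟙_ C`. -/
class CartesianLeftAdditive (C : Type u) [Category.{v} C] [CartesianMonoidalCategory C]
    [SymmetricCategory C] where
  add (A : C) : A ⊗ A ⟶ A
  zero (A : C) : 𝟙_ C ⟶ A
  add_comm (A : C) : (β_ A A).hom ≫ add A = add A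
  add_assoc (A : C) : (add A ▷ A) ≫ add A = (α_ A A A).hom ≫ (A ◁ add A) ≫ add A
  zero_add (A : C) : (zero A ▷ A) ≫ add A = (λ_ A).hom
  add_tensor (A B : C) : add (A ⊗ B) = tensorμ A B A B ≫ (add A ⊗ₘ add B)
  zero_tensor (A B : C) : zero (A ⊗ B) = (λ_ (𝟙_ C)).inv ≫ (zero A ⊗ₘ zero B)

namespace CartesianLeftAdditive

section
variable {C : Type u} [Category.{v} C] [CartesianMonoidalCategory C] [SymmetricCategory C]
  [CartesianLeftAdditive C]

/-- The zero morphism: discard, then zero. -/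
def zeroHom (A B : C) : A ⟶ B := toUnit A ≫ zero B

/-- The pointwise sum of two parallel morphisms. -/
def sumHom {A B : C} (f g : A ⟶ B) : A ⟶ B := lift f g ≫ add B

/-- Additivity of `r : A ⊗ B ⟶ A` in its second argument (the change):
`r (a, b + b') = r (a, b) + r (a, b')` and `r (a, 0) = 0`. -/
def AdditiveInChange {A B : C} (r : A ⊗ B ⟶ A) : Prop :=
  (A ◁ add B) ≫ r = sumHom ((A ◁ fst B B) ≫ r) ((A ◁ snd B B) ≫ r) ∧
  (A ◁ zero B) ≫ r = zeroHom (A ⊗ 𝟙_ C) A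

/-- The forward derivative `D[f] : A ⊗ A ⟶ B` of `f : A ⟶ B`, as a function of the second iterate
`r₂ = R[R[f]]` of the reverse derivative: `D[f] (a, a') = π₁ (r₂ ((a, 0), a'))`. -/
def forward {A B : C} (r₂ : (A ⊗ B) ⊗ A ⟶ A ⊗ B) : A ⊗ A ⟶ B :=
  (lift (𝟙 A) (zeroHom A B) ▷ A) ≫ r₂ ≫ snd A B

/-- The partial forward derivative `D_B[g] : A ⊗ (B ⊗ B) ⟶ X` of `g : A ⊗ B ⟶ X`, as a function of
`r₂ = R[R[g]]`: `D_B[g] (a, (b, b')) = D[g] ((a, b), (0, b'))`. -/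
def partialForward {A B X : C} (r₂ : ((A ⊗ B) ⊗ X) ⊗ (A ⊗ B) ⟶ (A ⊗ B) ⊗ X) :
    A ⊗ (B ⊗ B) ⟶ X :=
  lift (A ◁ fst B B) (lift (zeroHom (A ⊗ (B ⊗ B)) A) (snd A (B ⊗ B) ≫ snd B B)) ≫ forward r₂

/-- Linearity of `r = R[f] : A ⊗ B ⟶ A` in the change, where `r₃ = R[R[r]]`:
`D_B[r] (a, (b, b')) = r (a, b')`. -/
def LinearInChange {A B : C} (r : A ⊗ B ⟶ A)
    (r₃ : ((A ⊗ B) ⊗ A) ⊗ (A ⊗ B) ⟶ (A ⊗ B) ⊗ A) : Prop :=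
  partialForward r₃ = (A ◁ snd B B) ≫ r

/-- Symmetry of a second forward derivative `d₂ = D[D[f]] : (A ⊗ A) ⊗ (A ⊗ A) ⟶ B`:
`d₂ ((a, b), (c, d)) = d₂ ((a, c), (b, d))`. -/
def SymmetricSecond {A B : C} (d₂ : (A ⊗ A) ⊗ (A ⊗ A) ⟶ B) : Prop :=
  d₂ = tensorμ A A A A ≫ d₂

end

end CartesianLeftAdditive

open CartesianLeftAdditive in
/-- A reverse derivative category: a cartesian left-additive category with a reverse differential
combinator `R` satisfying the structural axioms, additivity of change, linearity of change and
symmetry of partials. -/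
class ReverseDerivativeCategory (C : Type u) [Category.{v} C] [CartesianMonoidalCategory C]
    [SymmetricCategory C] [CartesianLeftAdditive C] where
  R {A B : C} (f : A ⟶ B) : A ⊗ B ⟶ A
  R_id (A : C) : R (𝟙 A) = snd A A
  R_swap (A B : C) : R (β_ A B).hom = snd (A ⊗ B) (B ⊗ A) ≫ (β_ B A).hom
  R_copy (A : C) : R (lift (𝟙 A) (𝟙 A)) = snd A (A ⊗ A) ≫ add A
  R_discard (A : C) : R (toUnit A) = zeroHom (A ⊗ 𝟙_ C) A
  R_add (A : C) : R (add A) = snd (A ⊗ A) A ≫ lift (𝟙 A) (𝟙 A)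
  R_zero (A : C) : R (zero A) = toUnit (𝟙_ C ⊗ A)
  R_comp {A B D : C} (f : A ⟶ B) (g : B ⟶ D) :
    R (f ≫ g) = lift (fst A D) ((f ▷ D) ≫ R g) ≫ R f
  R_tensor {A B A' B' : C} (f : A ⟶ B) (g : A' ⟶ B') :
    R (f ⊗ₘ g) = tensorμ A A' B B' ≫ (R f ⊗ₘ R g)
  additive_change {A B : C} (f : A ⟶ B) : AdditiveInChange (R f)
  linear_change {A B : C} (f : A ⟶ B) : LinearInChange (R f) (R (R (R f)))
  symmetric_partials {A B : C} (f : A ⟶ B) :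
    SymmetricSecond (forward (R (R (forward (R (R f))))))

/-! ### Terms -/

namespace CLA

/-- Cartesian left-additive terms over the generating objects `O` and the generating morphisms
`S a b` of arity `a` and coarity `b`. The monoidal product is strict: it is concatenation of words.
Identities and symmetries belong to the (strict) symmetric monoidal structure. -/
inductive Term {O : Type u} (S : List O → List O → Type v) : List O → List O → Type (max u v)
  | gen {a b : List O} (s : S a b) : Term S a b
  | id (a : List O) : Term S a a
  | swap (a b : List O) : Term S (a ++ b) (b ++ a)
  | copy (A : O) : Term S [A] [A, A]
  | discard (A : O) : Term S [A] []
  | add (A : O) : Term S [A, A] [A]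
  | zero (A : O) : Term S [] [A]
  | comp {a b c : List O} (f : Term S a b) (g : Term S b c) : Term S a c
  | tensor {a b a' b' : List O} (f : Term S a b) (g : Term S a' b') : Term S (a ++ a') (b ++ b')

namespace Term

variable {O : Type u} {S : List O → List O → Type v}

/-- The identity term, between two expressions for the same word. -/
def ofEq {a b : List O} (h : a = b) : Term S a b := h ▸ id a

/-- Exchange of the two middle words. -/
def mid (a b c d : List O) : Term S ((a ++ b) ++ (c ++ d)) ((a ++ c) ++ (b ++ d)) :=
  comp (ofEq (by simp : (a ++ b) ++ (c ++ d) = a ++ ((b ++ c) ++ d)))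
    (comp (tensor (id a) (tensor (swap b c) (id d)))
      (ofEq (by simp : a ++ ((c ++ b) ++ d) = (a ++ c) ++ (b ++ d))))

/-- Copy on words. -/
def copyW : ∀ a : List O, Term S a (a ++ a)
  | [] => id []
  | A :: a => comp (tensor (copy A) (copyW a)) (mid [A] [A] a a)

/-- Discard on words. -/
def discardW : ∀ a : List O, Term S a []
  | [] => id []
  | A :: a => tensor (discard A) (discardW a)

/-- Addition on words. -/
def addW : ∀ a : List O, Term S (a ++ a) a
  | [] => id []
  | A :: a => comp (mid [A] a [A] a) (tensor (add A) (addW a))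

/-- Zero on words. -/
def zeroW : ∀ a : List O, Term S [] a
  | [] => id []
  | A :: a => tensor (zero A) (zeroW a)

/-- The extension to all terms, prescribed by the structural axioms of a reverse differential
combinator, of an assignment `R₀` of reverse derivatives to the generating morphisms. -/
def rev (R₀ : ∀ ⦃a b : List O⦄, S a b → Term S (a ++ b) a) :
    ∀ {a b : List O}, Term S a b → Term S (a ++ b) a
  | _, _, gen s => R₀ s
  | _, _, id a => tensor (discardW a) (id a)
  | _, _, swap a b => comp (tensor (discardW (a ++ b)) (id (b ++ a))) (swap b a)
  | _, _, copy A => tensor (discard A) (add A)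
  | _, _, discard A => comp (discard A) (zero A)
  | _, _, add A => tensor (discardW [A, A]) (copy A)
  | _, _, zero A => discard A
  | _, _, @comp _ _ a _ c f g =>
      comp (tensor (copyW a) (id c))
        (comp (ofEq (List.append_assoc a a c))
          (comp (tensor (id a) (comp (tensor f (id c)) (rev R₀ g))) (rev R₀ f)))
  | _, _, @tensor _ _ a b a' b' f g => comp (mid a a' b b') (tensor (rev R₀ f) (rev R₀ g))

/-- The forward derivative of a term, `D[t] (x, x') = π₁ (R[R[t]] ((x, 0), x'))`. -/
def fwd (R₀ : ∀ ⦃a b : List O⦄, S a b → Term S (a ++ b) a) {a b : List O} (t : Term S a b) :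
    Term S (a ++ a) b :=
  comp (tensor (comp (ofEq (List.append_nil a).symm) (tensor (id a) (zeroW b))) (id a))
    (comp (rev R₀ (rev R₀ t)) (tensor (discardW a) (id b)))

/-- The congruence on terms generated by the laws of cartesian left-additive categories (with strict
monoidal product) and the equations `E`. -/
inductive Rel (E : ∀ ⦃a b : List O⦄, Term S a b → Term S a b → Prop) :
    ∀ {a b : List O}, Term S a b → Term S a b → Prop
  /- the given equations -/
  | eqn {a b} {f g : Term S a b} (h : E f g) : Rel E f g
  /- congruence -/
  | refl {a b} (f : Term S a b) : Rel E f f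
  | symm {a b} {f g : Term S a b} (h : Rel E f g) : Rel E g f
  | trans {a b} {f g k : Term S a b} (h : Rel E f g) (h' : Rel E g k) : Rel E f k
  | comp_congr {a b c} {f f' : Term S a b} {g g' : Term S b c}
      (h : Rel E f f') (h' : Rel E g g') : Rel E (comp f g) (comp f' g')
  | tensor_congr {a b a' b'} {f f' : Term S a b} {g g' : Term S a' b'}
      (h : Rel E f f') (h' : Rel E g g') : Rel E (tensor f g) (tensor f' g')
  /- category -/
  | id_comp {a b} (f : Term S a b) : Rel E (comp (id a) f) f
  | comp_id {a b} (f : Term S a b) : Rel E (comp f (id b)) f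
  | comp_assoc {a b c d} (f : Term S a b) (g : Term S b c) (h : Term S c d) :
      Rel E (comp (comp f g) h) (comp f (comp g h))
  /- strict monoidal category -/
  | tensor_id (a b) : Rel E (tensor (id a) (id b)) (id (a ++ b))
  | tensor_comp {a b c a' b' c'} (f : Term S a b) (g : Term S b c)
      (f' : Term S a' b') (g' : Term S b' c') :
      Rel E (tensor (comp f g) (comp f' g')) (comp (tensor f f') (tensor g g'))
  | tensor_assoc {a b a' b' a'' b''} (f : Term S a b) (g : Term S a' b') (h : Term S a'' b'') :
      Rel E (comp (tensor (tensor f g) h) (ofEq (List.append_assoc b b' b'')))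
        (comp (ofEq (List.append_assoc a a' a'')) (tensor f (tensor g h)))
  | nil_tensor {a b} (f : Term S a b) : Rel E (tensor (id []) f) f
  | tensor_nil {a b} (f : Term S a b) :
      Rel E (comp (tensor f (id [])) (ofEq (List.append_nil b)))
        (comp (ofEq (List.append_nil a)) f)
  /- symmetry -/
  | swap_natural {a b a' b'} (f : Term S a b) (g : Term S a' b') :
      Rel E (comp (tensor f g) (swap b b')) (comp (swap a a') (tensor g f))
  | swap_swap (a b) : Rel E (comp (swap a b) (swap b a)) (id (a ++ b))
  | hexagon (a b c) :
      Rel E (comp (ofEq (List.append_assoc a b c))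
          (comp (swap a (b ++ c)) (ofEq (List.append_assoc b c a))))
        (comp (tensor (swap a b) (id c))
          (comp (ofEq (List.append_assoc b a c)) (tensor (id b) (swap a c))))
  /- natural commutative comonoids -/
  | copy_comm (a) : Rel E (comp (copyW a) (swap a a)) (copyW a)
  | copy_assoc (a) :
      Rel E (comp (copyW a) (comp (tensor (copyW a) (id a)) (ofEq (List.append_assoc a a a))))
        (comp (copyW a) (tensor (id a) (copyW a)))
  | copy_counit (a) : Rel E (comp (copyW a) (tensor (discardW a) (id a))) (id a)
  | copy_natural {a b} (f : Term S a b) :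
      Rel E (comp f (copyW b)) (comp (copyW a) (tensor f f))
  | discard_natural {a b} (f : Term S a b) : Rel E (comp f (discardW b)) (discardW a)
  | copy_tensor (a b) :
      Rel E (copyW (a ++ b)) (comp (tensor (copyW a) (copyW b)) (mid a a b b))
  | discard_tensor (a b) : Rel E (discardW (a ++ b)) (tensor (discardW a) (discardW b))
  /- commutative monoids -/
  | add_comm (a) : Rel E (comp (swap a a) (addW a)) (addW a)
  | add_assoc (a) :
      Rel E (comp (tensor (addW a) (id a)) (addW a))
        (comp (ofEq (List.append_assoc a a a)) (comp (tensor (id a) (addW a)) (addW a)))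
  | zero_add (a) : Rel E (comp (tensor (zeroW a) (id a)) (addW a)) (id a)
  | add_tensor (a b) :
      Rel E (addW (a ++ b)) (comp (mid a b a b) (tensor (addW a) (addW b)))
  | zero_tensor (a b) : Rel E (zeroW (a ++ b)) (tensor (zeroW a) (zeroW b))

end Term

/-! ### The presented category -/

variable {O : Type u} {S : List O → List O → Type v}

/-- The objects of the cartesian left-additive category presented by the generators `(O, S)` and
the equations `E`: words over `O`. -/
structure Presented (E : ∀ ⦃a b : List O⦄, Term S a b → Term S a b → Prop) : Type u where
  word : List O

variable (E : ∀ ⦃a b : List O⦄, Term S a b → Term S a b → Prop)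

namespace Presented

/-- Equality of terms modulo the laws. -/
def setoid (a b : List O) : Setoid (Term S a b) where
  r := Term.Rel E
  iseqv := ⟨.refl, .symm, .trans⟩

instance category : Category (Presented E) where
  Hom X Y := Quotient (setoid E X.word Y.word)
  id X := Quotient.mk _ (.id X.word)
  comp := Quotient.map₂ .comp fun _ _ h _ _ h' => .comp_congr h h'
  id_comp := by rintro _ _ ⟨f⟩; exact Quotient.sound (.id_comp f)
  comp_id := by rintro _ _ ⟨f⟩; exact Quotient.sound (.comp_id f)
  assoc := by rintro _ _ _ _ ⟨f⟩ ⟨g⟩ ⟨h⟩; exact Quotient.sound (.comp_assoc f g h)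

/-- The morphism of the presented category represented by a term. -/
def hom {a b : List O} (t : Term S a b) : (⟨a⟩ : Presented E) ⟶ ⟨b⟩ :=
  Quotient.mk (setoid E a b) t

variable {E} in
theorem hom_eq {a b : List O} {f g : Term S a b} (h : Term.Rel E f g) : hom E f = hom E g :=
  Quotient.sound h

theorem hom_surj {X Y : Presented E} (f : X ⟶ Y) :
    ∃ t : Term S X.word Y.word, hom E t = f :=
  Quotient.exists_rep f

/-- The isomorphism between two expressions for the same word. -/
def ofEqIso {a b : List O} (h : a = b) : (⟨a⟩ : Presented E) ≅ ⟨b⟩ where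
  hom := hom E (.ofEq h)
  inv := hom E (.ofEq h.symm)
  hom_inv_id := by subst h; exact hom_eq (.id_comp _)
  inv_hom_id := by subst h; exact hom_eq (.id_comp _)

instance monoidalStruct : MonoidalCategoryStruct (Presented E) where
  tensorObj X Y := ⟨X.word ++ Y.word⟩
  whiskerLeft X _ _ f := Quotient.map (Term.tensor (.id X.word))
    (fun _ _ h => .tensor_congr (.refl _) h) f
  whiskerRight f Y := Quotient.map (fun t => Term.tensor t (.id Y.word))
    (fun _ _ h => .tensor_congr h (.refl _)) f
  tensorHom := Quotient.map₂ .tensor fun _ _ h _ _ h' => .tensor_congr h h'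
  tensorUnit := ⟨[]⟩
  associator X Y Z := ofEqIso E (List.append_assoc X.word Y.word Z.word)
  leftUnitor X := ofEqIso E (List.nil_append X.word)
  rightUnitor X := ofEqIso E (List.append_nil X.word)

theorem hom_ofEq_comp {a b c : List O} (h : a = b) (h' : b = c) :
    hom E (.comp (.ofEq h) (.ofEq h')) = hom E (.ofEq (h.trans h')) := by
  subst h h'; exact hom_eq (.id_comp _)

theorem hom_ofEq_tensor {a b a' b' : List O} (h : a = b) (h' : a' = b') :
    hom E (.tensor (.ofEq h) (.ofEq h')) = hom E (.ofEq (by rw [h, h'])) := by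
  subst h h'; exact hom_eq (.tensor_id _ _)

instance monoidal : MonoidalCategory (Presented E) :=
  .ofTensorHom
    (id_tensorHom_id := fun X Y => hom_eq (.tensor_id X.word Y.word))
    (id_tensorHom := by rintro X _ _ ⟨f⟩; rfl)
    (tensorHom_id := by rintro _ _ ⟨f⟩ Y; rfl)
    (tensorHom_comp_tensorHom := by
      rintro _ _ _ _ _ _ ⟨f⟩ ⟨f'⟩ ⟨g⟩ ⟨g'⟩
      exact (hom_eq (.tensor_comp f g f' g')).symm)
    (associator_naturality := by
      rintro _ _ _ _ _ _ ⟨f⟩ ⟨g⟩ ⟨h⟩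
      exact hom_eq (.tensor_assoc f g h))
    (leftUnitor_naturality := by
      rintro _ _ ⟨f⟩
      exact hom_eq (.trans (.comp_id _) (.trans (.nil_tensor f) (.symm (.id_comp f)))))
    (rightUnitor_naturality := by
      rintro _ _ ⟨f⟩
      exact hom_eq (.tensor_nil f))
    (pentagon := by
      rintro ⟨a⟩ ⟨b⟩ ⟨c⟩ ⟨d⟩
      have h₁ := hom_ofEq_tensor E (List.append_assoc a b c) (rfl : d = d)
      have h₂ := hom_ofEq_tensor E (rfl : a = a) (List.append_assoc b c d)
      change hom E (.tensor (.ofEq _) (.ofEq rfl)) ≫ hom E (.ofEq _) ≫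
        hom E (.tensor (.ofEq rfl) (.ofEq _)) = hom E (.comp (.ofEq _) (.ofEq _))
      rw [h₁, h₂, hom_ofEq_comp]
      change _ ≫ hom E (.comp (.ofEq _) (.ofEq _)) = _
      rw [hom_ofEq_comp]
      exact hom_ofEq_comp E _ _)
    (triangle := by
      rintro ⟨a⟩ ⟨b⟩
      change hom E (.ofEq _) ≫ hom E (.tensor (.ofEq rfl) (.ofEq _)) =
        hom E (.tensor (.ofEq _) (.ofEq rfl))
      rw [hom_ofEq_tensor, hom_ofEq_tensor]
      exact hom_ofEq_comp E _ _)

/-- The empty word is terminal. -/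
def isTerminalUnit : Limits.IsTerminal (𝟙_ (Presented E)) :=
  Limits.IsTerminal.ofUniqueHom (fun X => hom E (.discardW X.word)) (by
    rintro X ⟨f⟩
    exact hom_eq (.trans (.symm (.comp_id f)) (.discard_natural f)))

instance semiCartesian : SemiCartesianMonoidalCategory (Presented E) where
  isTerminalTensorUnit := isTerminalUnit E
  fst X Y := X ◁ (isTerminalUnit E).from Y ≫ (ρ_ X).hom
  snd X Y := (isTerminalUnit E).from X ▷ Y ≫ (λ_ Y).hom
  fst_def _ _ := rfl
  snd_def _ _ := rfl

/-- The symmetry of the presented category. -/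
def swapIso (X Y : Presented E) : X ⊗ Y ≅ Y ⊗ X where
  hom := hom E (.swap X.word Y.word)
  inv := hom E (.swap Y.word X.word)
  hom_inv_id := hom_eq (.swap_swap _ _)
  inv_hom_id := hom_eq (.swap_swap _ _)

theorem swap_hexagon (X Y Z : Presented E) :
    (α_ X Y Z).hom ≫ (swapIso E X (Y ⊗ Z)).hom ≫ (α_ Y Z X).hom =
      ((swapIso E X Y).hom ▷ Z) ≫ (α_ Y X Z).hom ≫ (Y ◁ (swapIso E X Z).hom) :=
  hom_eq (.hexagon X.word Y.word Z.word)

instance symmetric : SymmetricCategory (Presented E) where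
  braiding := swapIso E
  braiding_naturality_right := by
    rintro X _ _ ⟨f⟩; exact hom_eq (.swap_natural _ f)
  braiding_naturality_left := by
    rintro _ _ ⟨f⟩ Z; exact hom_eq (.swap_natural f _)
  hexagon_forward := swap_hexagon E
  hexagon_reverse X Y Z := by
    have h : α_ Z X Y ≪≫ swapIso E Z (X ⊗ Y) ≪≫ α_ X Y Z =
        whiskerRightIso (swapIso E Z X) Y ≪≫ α_ X Z Y ≪≫ whiskerLeftIso X (swapIso E Z Y) :=
      Iso.ext (swap_hexagon E Z X Y)
    have h' := congrArg Iso.inv h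
    simp only [Iso.trans_inv, whiskerRightIso_inv, whiskerLeftIso_inv, Category.assoc] at h'
    exact h'
  symmetry X Y := hom_eq (.swap_swap _ _)

theorem hom_comp {a b c : List O} (f : Term S a b) (g : Term S b c) :
    hom E (.comp f g) = hom E f ≫ hom E g := rfl

theorem hom_tensor {a b a' b' : List O} (f : Term S a b) (g : Term S a' b') :
    hom E (.tensor f g) =
      (hom E f ⊗ₘ hom E g : (⟨a⟩ : Presented E) ⊗ ⟨a'⟩ ⟶ ⟨b⟩ ⊗ ⟨b'⟩) := rfl

theorem hom_mid (a b c d : List O) :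
    hom E (.mid a b c d) = tensorμ (⟨a⟩ : Presented E) ⟨b⟩ ⟨c⟩ ⟨d⟩ := by
  have key : ∀ {a₁ a₂ a₃ b₁ b₂ b₃ : List O} (h₁ : a₁ = a₂) (h₂ : a₂ = a₃) (h₃ : a₁ = a₃)
      (k₁ : b₁ = b₂) (k₂ : b₂ = b₃) (k₃ : b₁ = b₃) (t : Term S a₃ b₁),
      hom E (.ofEq h₃) ≫ hom E t ≫ hom E (.ofEq k₃) =
        hom E (.ofEq h₁) ≫ hom E (.ofEq h₂) ≫ hom E t ≫ hom E (.ofEq k₁) ≫ hom E (.ofEq k₂) := by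
    rintro _ _ _ _ _ _ rfl rfl _ rfl rfl _ t
    have hid : ∀ a : List O, hom E (.ofEq (rfl : a = a)) = 𝟙 (⟨a⟩ : Presented E) := fun _ => rfl
    simp only [hid, Category.id_comp]
  change hom E (.ofEq _) ≫ hom E (.tensor (.id a) (.tensor (.swap b c) (.id d))) ≫
    hom E (.ofEq _) = hom E (.ofEq _) ≫ hom E (.tensor (.ofEq rfl) (.ofEq _)) ≫
      hom E (.tensor (.id a) (.tensor (.swap b c) (.id d))) ≫
      hom E (.tensor (.ofEq rfl) (.ofEq _)) ≫ hom E (.ofEq _)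
  rw [hom_ofEq_tensor, hom_ofEq_tensor]
  exact key _ _ _ _ _ _ _

/-- The copy morphism. -/
def copyHom (X : Presented E) : X ⟶ X ⊗ X := hom E (.copyW X.word)

theorem tensor_fst {X Y X' Y' : Presented E} (f : X ⟶ X') (g : Y ⟶ Y') :
    (f ⊗ₘ g) ≫ fst X' Y' = fst X Y ≫ f := by
  have h : g ≫ isTerminalTensorUnit.from Y' = isTerminalTensorUnit.from Y :=
    isTerminalTensorUnit.hom_ext _ _
  rw [fst_def, fst_def, tensorHom_def_assoc, ← whiskerLeft_comp_assoc, h, ← whisker_exchange_assoc,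
    rightUnitor_naturality, Category.assoc]

theorem tensor_snd {X Y X' Y' : Presented E} (f : X ⟶ X') (g : Y ⟶ Y') :
    (f ⊗ₘ g) ≫ snd X' Y' = snd X Y ≫ g := by
  have h : f ≫ isTerminalTensorUnit.from X' = isTerminalTensorUnit.from X :=
    isTerminalTensorUnit.hom_ext _ _
  rw [snd_def, snd_def, tensorHom_def'_assoc, ← comp_whiskerRight_assoc, h, whisker_exchange_assoc,
    leftUnitor_naturality, Category.assoc]

theorem copy_snd (X : Presented E) : copyHom E X ≫ snd X X = 𝟙 X :=
  hom_eq (.trans (.comp_congr (.refl _) (.comp_id _)) (.copy_counit X.word))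

theorem copy_fst (X : Presented E) : copyHom E X ≫ fst X X = 𝟙 X := by
  have h : copyHom E X ≫ (β_ X X).hom = copyHom E X := hom_eq (.copy_comm X.word)
  have h' : (β_ X X).hom ≫ fst X X = snd X X := by
    simp [fst_def, snd_def, ← BraidedCategory.braiding_naturality_left_assoc]
  rw [← h, Category.assoc, h', copy_snd]

theorem copy_tensor_fst_snd (X Y : Presented E) :
    copyHom E (X ⊗ Y) ≫ (fst X Y ⊗ₘ snd X Y) = 𝟙 (X ⊗ Y) := by
  have h : copyHom E (X ⊗ Y) = (copyHom E X ⊗ₘ copyHom E Y) ≫ tensorμ X X Y Y := by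
    rw [← hom_mid]
    exact hom_eq (.copy_tensor X.word Y.word)
  have h₂ : tensorμ X X Y Y ≫ (fst X Y ⊗ₘ snd X Y) = (fst X X ⊗ₘ snd Y Y) := by
    have h₃ := tensorμ_natural (𝟙 X) (isTerminalTensorUnit.from X) (isTerminalTensorUnit.from Y)
      (𝟙 Y)
    have h₄ : tensorμ X (𝟙_ (Presented E)) (𝟙_ _) Y ≫ ((ρ_ X).hom ⊗ₘ (λ_ Y).hom) =
        ((ρ_ X).hom ⊗ₘ (λ_ Y).hom) := by
      have h₅ : (β_ (𝟙_ (Presented E)) (𝟙_ _)).hom = 𝟙 _ := by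
        simp [← unitors_equal]
      simp only [tensorμ, h₅, id_whiskerRight, MonoidalCategory.whiskerLeft_id, Category.id_comp]
      monoidal
    simp only [fst_def, snd_def, ← id_tensorHom, ← tensorHom_id, ← tensorHom_comp_tensorHom]
    rw [← reassoc_of% h₃, h₄]
  rw [h, Category.assoc, h₂, tensorHom_comp_tensorHom, copy_fst, copy_snd, id_tensorHom_id]

theorem copy_nat {X Y : Presented E} (f : X ⟶ Y) :
    f ≫ copyHom E Y = copyHom E X ≫ (f ⊗ₘ f) := by
  obtain ⟨f⟩ := f
  exact hom_eq (.copy_natural f)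

instance cartesian : CartesianMonoidalCategory (Presented E) where
  tensorProductIsBinaryProduct X Y :=
    Limits.BinaryFan.IsLimit.mk _ (fun f g => copyHom E _ ≫ (f ⊗ₘ g))
      (fun f g => by
        change (copyHom E _ ≫ (f ⊗ₘ g)) ≫ fst X Y = f
        rw [Category.assoc, tensor_fst, ← Category.assoc, copy_fst, Category.id_comp])
      (fun f g => by
        change (copyHom E _ ≫ (f ⊗ₘ g)) ≫ snd X Y = g
        rw [Category.assoc, tensor_snd, ← Category.assoc, copy_snd, Category.id_comp])
      (fun f g m hf hg => by
        change _ ≫ fst X Y = _ at hf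
        change _ ≫ snd X Y = _ at hg
        subst hf hg
        rw [← tensorHom_comp_tensorHom, ← Category.assoc, ← copy_nat, Category.assoc,
          copy_tensor_fst_snd, Category.comp_id])

theorem lift_eq {T X Y : Presented E} (f : T ⟶ X) (g : T ⟶ Y) :
    lift f g = copyHom E T ≫ (f ⊗ₘ g) := rfl

instance leftAdditive : CartesianLeftAdditive (Presented E) where
  add X := hom E (.addW X.word)
  zero X := hom E (.zeroW X.word)
  add_comm X := hom_eq (.add_comm X.word)
  add_assoc X := hom_eq (.add_assoc X.word)
  zero_add X := hom_eq (.trans (.zero_add X.word) (.refl _))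
  add_tensor X Y := by
    rw [← hom_mid]
    exact hom_eq (.add_tensor X.word Y.word)
  zero_tensor X Y := by
    have h := hom_eq (E := E) (.zero_tensor X.word Y.word)
    exact h.trans (Category.id_comp _).symm

end Presented
end CLA

/-! Pair each term with its reverse derivative: a morphism `get` with a candidate `put` is a lens.
The reverse chain rule and the tensor formula are composition and monoidal product of lenses, so
extending `R₀` to terms is interpreting terms as lenses (`lens_comp`, `lens_tensor`). Descent to the
presented category means that this interpretation respects the laws, proved in `lens_eq_of_rel`. The
categorical and naturality laws of the symmetric monoidal structure hold for arbitrary lenses.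
Structural maps are linear, with a known transpose: copy and addition are exchanged, as are discard
and zero. Hence each law among them requires that law together with its transpose, which is again a
law (`HasTranspose.lens_eq`). Naturality of copy and discard is exactly additivity in the change,
which therefore has to be established on all terms first (`additiveInChange_rev`). The equations of
`E` are covered by hypothesis.

Once `R` acts on morphisms, ARD.3 and ARD.4 propagate by induction. The forward derivative obeys the
chain rule `D[f;g](x,x') = D[g](f x, D[f](x,x'))` and acts componentwise on pairings; this uses only
the structural axioms and additivity. Both axioms are clear for maps with a two-sided transpose,
since there `D[f](x,x') = f x'`. The chain rule then shows that they are stable under composition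
and tensor. -/

set_option linter.unusedSectionVars false

/-! ### Generalized elements of cartesian left-additive categories -/

namespace CartesianLeftAdditive

section
variable {C : Type u} [Category.{v} C] [CartesianMonoidalCategory C]

/-- Yoneda for a product: the generic pair of elements is the pair of projections. This licenses the
elementwise calculations below. -/
theorem hom_ext_lift {A B X : C} {f g : A ⊗ B ⟶ X}
    (h : ∀ ⦃T : C⦄ (x : T ⟶ A) (y : T ⟶ B), lift x y ≫ f = lift x y ≫ g) : f = g := by
  simpa using h (fst A B) (snd A B)

theorem exists_eq_lift {T A B : C} (z : T ⟶ A ⊗ B) :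
    ∃ (x : T ⟶ A) (y : T ⟶ B), z = lift x y :=
  ⟨z ≫ fst A B, z ≫ snd A B, by simp⟩

theorem lift_leftUnitor_inv {T A : C} (x : T ⟶ A) :
    x ≫ (λ_ A).inv = lift (toUnit T) x := by
  apply hom_ext <;> simp

theorem lift_rightUnitor_inv {T A : C} (x : T ⟶ A) :
    x ≫ (ρ_ A).inv = lift x (toUnit T) := by
  apply hom_ext <;> simp

variable [SymmetricCategory C]

theorem lift_lift_tensorμ {T A B A' B' : C} (a : T ⟶ A) (b : T ⟶ B) (a' : T ⟶ A') (b' : T ⟶ B') :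
    lift (lift a b) (lift a' b') ≫ tensorμ A B A' B' = lift (lift a a') (lift b b') := by
  apply hom_ext <;> simp

theorem lift_lift_tensorμ_assoc {T A B A' B' X : C} (a : T ⟶ A) (b : T ⟶ B) (a' : T ⟶ A')
    (b' : T ⟶ B') (f : (A ⊗ A') ⊗ B ⊗ B' ⟶ X) :
    lift (lift a b) (lift a' b') ≫ tensorμ A B A' B' ≫ f = lift (lift a a') (lift b b') ≫ f := by
  rw [← Category.assoc, lift_lift_tensorμ]

/-- The left side has the shape of copy on a one-letter word, built recursively from copy on the
letter and on the empty word. The next lemma is the analogue for addition. -/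
theorem tensor_leftUnitor_inv_tensorμ {A B D : C} (f : A ⟶ B ⊗ D) :
    (f ⊗ₘ (λ_ (𝟙_ C)).inv) ≫ tensorμ B D (𝟙_ C) (𝟙_ C) =
      (ρ_ A).hom ≫ f ≫ ((ρ_ B).inv ⊗ₘ (ρ_ D).inv) := by
  refine hom_ext_lift fun T x y => ?_
  obtain ⟨p, q, h⟩ := exists_eq_lift (x ≫ f)
  simp only [lift_map_assoc, lift_rightUnitor_hom_assoc, h, reassoc_of% h, lift_leftUnitor_inv,
    lift_map, lift_rightUnitor_inv, lift_lift_tensorμ]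
  rw [toUnit_unique y (toUnit T)]

theorem tensorμ_tensor_leftUnitor_hom {A B D : C} (f : A ⊗ B ⟶ D) :
    tensorμ A (𝟙_ C) B (𝟙_ C) ≫ (f ⊗ₘ (λ_ (𝟙_ C)).hom) =
      ((ρ_ A).hom ⊗ₘ (ρ_ B).hom) ≫ f ≫ (ρ_ D).inv := by
  refine hom_ext_lift fun T x y => ?_
  obtain ⟨a, e, rfl⟩ := exists_eq_lift x
  obtain ⟨b, e', rfl⟩ := exists_eq_lift y
  simp only [lift_map_assoc, lift_rightUnitor_hom, lift_lift_tensorμ_assoc, lift_map,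
    lift_leftUnitor_hom]
  rw [← Category.assoc, lift_rightUnitor_inv, toUnit_unique e' (toUnit T)]

/-! ### Pointwise sums of morphisms -/

variable [CartesianLeftAdditive C]

instance {A B : C} : Zero (A ⟶ B) := ⟨zeroHom A B⟩

instance {A B : C} : Add (A ⟶ B) := ⟨sumHom⟩

/-- The pointwise commutative monoid structure on the morphisms of a cartesian left-additive
category. -/
instance homAddCommMonoid {A B : C} : AddCommMonoid (A ⟶ B) :=
  have comm (f g : A ⟶ B) : sumHom f g = sumHom g f := by
    rw [sumHom, ← CartesianLeftAdditive.add_comm, lift_braiding_hom_assoc, sumHom]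
  have zadd (f : A ⟶ B) : sumHom (zeroHom A B) f = f := by
    have h : lift (zeroHom A B) f = lift (toUnit A) f ≫ (zero B ▷ B) := by simp [zeroHom]
    rw [sumHom, h, Category.assoc, CartesianLeftAdditive.zero_add, lift_leftUnitor_hom]
  { add_assoc := fun f g k => by
      have h : lift (lift f g ≫ add B) k = lift (lift f g) k ≫ (add B ▷ B) := by simp
      change lift (lift f g ≫ add B) k ≫ add B = lift f (lift g k ≫ add B) ≫ add B
      rw [h, Category.assoc, CartesianLeftAdditive.add_assoc]
      simp
    add_comm := comm
    zero_add := zadd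
    add_zero := fun f => (comm _ _).trans (zadd f)
    nsmul := nsmulRec }

theorem sumHom_eq_add {A B : C} (f g : A ⟶ B) : sumHom f g = f + g := rfl

theorem zeroHom_eq_zero (A B : C) : zeroHom A B = 0 := rfl

@[simp]
theorem lift_add {A B : C} (f g : A ⟶ B) : lift f g ≫ add B = f + g := rfl

@[simp]
theorem toUnit_zero (A B : C) : toUnit A ≫ zero B = 0 := rfl

@[simp]
theorem comp_zero_map {A B : C} (x : A ⟶ 𝟙_ C) : x ≫ zero B = 0 := by
  rw [toUnit_unique x (toUnit A), toUnit_zero]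

-- Sums are formed by postcomposing with `add`, so precomposition always preserves them.
-- Postcomposition need not, which is why `IsAdditive` is a condition.
@[simp]
theorem comp_hom_add {A B D : C} (h : A ⟶ B) (f g : B ⟶ D) : h ≫ (f + g) = h ≫ f + h ≫ g := by
  rw [← lift_add, ← lift_add, comp_lift_assoc]

@[simp]
theorem comp_hom_zero {A B D : C} (h : A ⟶ B) : h ≫ (0 : B ⟶ D) = 0 := by
  rw [← toUnit_zero, ← Category.assoc, comp_zero_map]

@[simp]
theorem lift_add_lift {T A B : C} (a a' : T ⟶ A) (b b' : T ⟶ B) :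
    lift a b + lift a' b' = lift (a + a') (b + b') := by
  rw [← lift_add, add_tensor, lift_lift_tensorμ_assoc, lift_map, lift_add, lift_add]

@[simp]
theorem lift_zero_zero {T A B : C} : lift (0 : T ⟶ A) (0 : T ⟶ B) = 0 := by
  rw [← toUnit_zero T (A ⊗ B), zero_tensor, ← Category.assoc, lift_leftUnitor_inv, lift_map]
  simp

@[simp]
theorem zero_comp_fst {T A B : C} : (0 : T ⟶ A ⊗ B) ≫ fst A B = 0 := by
  rw [← lift_zero_zero, lift_fst]

@[simp]
theorem zero_comp_snd {T A B : C} : (0 : T ⟶ A ⊗ B) ≫ snd A B = 0 := by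
  rw [← lift_zero_zero, lift_snd]

theorem AdditiveInChange.lift_add {A B T : C} {r : A ⊗ B ⟶ A} (hr : AdditiveInChange r)
    (x : T ⟶ A) (y y' : T ⟶ B) : lift x (y + y') ≫ r = lift x y ≫ r + lift x y' ≫ r := by
  have h := congrArg (lift x (lift y y') ≫ ·) hr.1
  simpa [sumHom_eq_add] using h

theorem AdditiveInChange.lift_zero {A B T : C} {r : A ⊗ B ⟶ A} (hr : AdditiveInChange r)
    (x : T ⟶ A) : lift x (0 : T ⟶ B) ≫ r = 0 := by
  have h := congrArg (lift x (toUnit T) ≫ ·) hr.2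
  simpa [zeroHom_eq_zero] using h

theorem additiveInChange_of {A B : C} {r : A ⊗ B ⟶ A}
    (h : ∀ ⦃T : C⦄ (x : T ⟶ A) (y y' : T ⟶ B),
      lift x (y + y') ≫ r = lift x y ≫ r + lift x y' ≫ r)
    (h₀ : ∀ ⦃T : C⦄ (x : T ⟶ A), lift x (0 : T ⟶ B) ≫ r = 0) : AdditiveInChange r := by
  constructor
  · refine hom_ext_lift fun T x y => ?_
    obtain ⟨a, b, rfl⟩ := exists_eq_lift y
    simp [sumHom_eq_add, h]
  · refine hom_ext_lift fun T x y => ?_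
    simp [zeroHom_eq_zero, h₀]

/-- A morphism that is a homomorphism for the pointwise sums. -/
structure IsAdditive {A B : C} (f : A ⟶ B) : Prop where
  map_add {T : C} (x y : T ⟶ A) : (x + y) ≫ f = x ≫ f + y ≫ f
  map_zero {T : C} : (0 : T ⟶ A) ≫ f = 0

/-! ### Lenses -/

/-- A lens: a morphism with a candidate reverse derivative. -/
@[ext]
structure Lens (A B : C) where
  get : A ⟶ B
  put : A ⊗ B ⟶ A

namespace Lens

/-- Composition of lenses, by the reverse chain rule. -/
def comp {A B D : C} (f : Lens A B) (g : Lens B D) : Lens A D where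
  get := f.get ≫ g.get
  put := lift (fst A D) ((f.get ▷ D) ≫ g.put) ≫ f.put

/-- Monoidal product of lenses. -/
def tensor {A B A' B' : C} (f : Lens A B) (g : Lens A' B') : Lens (A ⊗ A') (B ⊗ B') where
  get := f.get ⊗ₘ g.get
  put := tensorμ A A' B B' ≫ (f.put ⊗ₘ g.put)

/-- The lens of a linear morphism with a given transpose. -/
def lin {A B : C} (f : A ⟶ B) (f' : B ⟶ A) : Lens A B where
  get := f
  put := snd A B ≫ f'

@[simp]
theorem comp_get {A B D : C} (f : Lens A B) (g : Lens B D) :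
    (f.comp g).get = f.get ≫ g.get := rfl

@[simp]
theorem tensor_get {A B A' B' : C} (f : Lens A B) (g : Lens A' B') :
    (f.tensor g).get = f.get ⊗ₘ g.get := rfl

@[simp]
theorem lin_get {A B : C} (f : A ⟶ B) (f' : B ⟶ A) : (lin f f').get = f := rfl

@[simp]
theorem lift_comp_put {A B D T : C} (f : Lens A B) (g : Lens B D) (x : T ⟶ A) (y : T ⟶ D) :
    lift x y ≫ (f.comp g).put = lift x (lift (x ≫ f.get) y ≫ g.put) ≫ f.put := by
  simp [comp, comp_lift_assoc]

@[simp]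
theorem lift_tensor_put {A B A' B' T : C} (f : Lens A B) (g : Lens A' B') (x : T ⟶ A)
    (x' : T ⟶ A') (y : T ⟶ B) (y' : T ⟶ B') :
    lift (lift x x') (lift y y') ≫ (f.tensor g).put =
      lift (lift x y ≫ f.put) (lift x' y' ≫ g.put) := by
  simp [tensor, lift_lift_tensorμ_assoc]

@[simp]
theorem lift_lin_put {A B T : C} (f : A ⟶ B) (f' : B ⟶ A) (x : T ⟶ A) (y : T ⟶ B) :
    lift x y ≫ (lin f f').put = y ≫ f' := by
  simp [lin]

/-! ### Laws of lenses -/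

theorem lin_comp_lin {A B D : C} (f : A ⟶ B) (f' : B ⟶ A) (g : B ⟶ D) (g' : D ⟶ B) :
    (lin f f').comp (lin g g') = lin (f ≫ g) (g' ≫ f') := by
  apply Lens.ext
  · rfl
  · refine hom_ext_lift fun T x y => ?_
    simp

theorem lin_tensor_lin {A B A' B' : C} (f : A ⟶ B) (f' : B ⟶ A) (g : A' ⟶ B') (g' : B' ⟶ A') :
    (lin f f').tensor (lin g g') = lin (f ⊗ₘ g) (f' ⊗ₘ g') := by
  apply Lens.ext
  · rfl
  · refine hom_ext_lift fun T x y => ?_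
    obtain ⟨a, b, rfl⟩ := exists_eq_lift x
    obtain ⟨a', b', rfl⟩ := exists_eq_lift y
    simp

theorem id_comp {A B : C} (f : Lens A B) : (lin (𝟙 A) (𝟙 A)).comp f = f := by
  apply Lens.ext
  · simp
  · refine hom_ext_lift fun T x y => ?_
    simp

theorem comp_id {A B : C} (f : Lens A B) : f.comp (lin (𝟙 B) (𝟙 B)) = f := by
  apply Lens.ext
  · simp
  · refine hom_ext_lift fun T x y => ?_
    simp

theorem comp_assoc {A B D X : C} (f : Lens A B) (g : Lens B D) (h : Lens D X) :
    (f.comp g).comp h = f.comp (g.comp h) := by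
  apply Lens.ext
  · simp
  · refine hom_ext_lift fun T x y => ?_
    simp

theorem tensor_comp {A B D A' B' D' : C} (f : Lens A B) (g : Lens B D) (f' : Lens A' B')
    (g' : Lens B' D') : (f.comp g).tensor (f'.comp g') = (f.tensor f').comp (g.tensor g') := by
  apply Lens.ext
  · simp
  · refine hom_ext_lift fun T x y => ?_
    obtain ⟨a, b, rfl⟩ := exists_eq_lift x
    obtain ⟨a', b', rfl⟩ := exists_eq_lift y
    simp

/-- Structural isomorphisms become linear lenses whose transpose is the inverse. -/
theorem tensor_assoc {A B A' B' A'' B'' : C} (f : Lens A B) (g : Lens A' B') (h : Lens A'' B'') :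
    ((f.tensor g).tensor h).comp (lin (α_ B B' B'').hom (α_ B B' B'').inv) =
      (lin (α_ A A' A'').hom (α_ A A' A'').inv).comp (f.tensor (g.tensor h)) := by
  apply Lens.ext
  · simp
  · refine hom_ext_lift fun T x y => ?_
    obtain ⟨x, a, rfl⟩ := exists_eq_lift x
    obtain ⟨b, c, rfl⟩ := exists_eq_lift x
    obtain ⟨b', y, rfl⟩ := exists_eq_lift y
    obtain ⟨a', c', rfl⟩ := exists_eq_lift y
    simp

theorem unit_tensor {A B : C} (f : Lens A B) :
    ((lin (𝟙 (𝟙_ C)) (𝟙 _)).tensor f).comp (lin (λ_ B).hom (λ_ B).inv) =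
      (lin (λ_ A).hom (λ_ A).inv).comp f := by
  apply Lens.ext
  · simp
  · refine hom_ext_lift fun T x y => ?_
    obtain ⟨a, b, rfl⟩ := exists_eq_lift x
    simp [lift_leftUnitor_inv]

theorem tensor_unit {A B : C} (f : Lens A B) :
    (f.tensor (lin (𝟙 (𝟙_ C)) (𝟙 _))).comp (lin (ρ_ B).hom (ρ_ B).inv) =
      (lin (ρ_ A).hom (ρ_ A).inv).comp f := by
  apply Lens.ext
  · simp
  · refine hom_ext_lift fun T x y => ?_
    obtain ⟨a, b, rfl⟩ := exists_eq_lift x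
    simp [lift_rightUnitor_inv]

theorem braiding_natural {A B A' B' : C} (f : Lens A B) (g : Lens A' B') :
    (f.tensor g).comp (lin (β_ B B').hom (β_ B' B).hom) =
      (lin (β_ A A').hom (β_ A' A).hom).comp (g.tensor f) := by
  apply Lens.ext
  · simp
  · refine hom_ext_lift fun T x y => ?_
    obtain ⟨a, b, rfl⟩ := exists_eq_lift x
    obtain ⟨a', b', rfl⟩ := exists_eq_lift y
    simp

/-- At `(x, (a, b))` the two reverse parts are `R[f](x, a + b)` and `R[f](x, a) + R[f](x, b)`, so
naturality of copy is the first half of additivity. Naturality of discard is the second half,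
`R[f](x, 0) = 0`. -/
theorem copy_natural {A B : C} (f : Lens A B) (hf : AdditiveInChange f.put) :
    f.comp (lin (lift (𝟙 B) (𝟙 B)) (add B)) =
      (lin (lift (𝟙 A) (𝟙 A)) (add A)).comp (f.tensor f) := by
  apply Lens.ext
  · simp
  · refine hom_ext_lift fun T x y => ?_
    obtain ⟨a, b, rfl⟩ := exists_eq_lift y
    simp [hf.lift_add]

theorem discard_natural {A B : C} (f : Lens A B) (hf : AdditiveInChange f.put) :
    f.comp (lin (toUnit B) (zero B)) = lin (toUnit A) (zero A) := by
  apply Lens.ext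
  · simp
  · refine hom_ext_lift fun T x y => ?_
    simp [hf.lift_zero]

theorem additiveInChange_lin {A B : C} (f : A ⟶ B) {f' : B ⟶ A} (hf' : IsAdditive f') :
    AdditiveInChange (lin f f').put :=
  additiveInChange_of (by simp [hf'.map_add]) (by simp [hf'.map_zero])

theorem additiveInChange_comp {A B D : C} (f : Lens A B) (g : Lens B D)
    (hf : AdditiveInChange f.put) (hg : AdditiveInChange g.put) :
    AdditiveInChange (f.comp g).put :=
  additiveInChange_of (by simp [hf.lift_add, hg.lift_add]) (by simp [hf.lift_zero, hg.lift_zero])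

theorem additiveInChange_tensor {A B A' B' : C} (f : Lens A B) (g : Lens A' B')
    (hf : AdditiveInChange f.put) (hg : AdditiveInChange g.put) :
    AdditiveInChange (f.tensor g).put := by
  refine additiveInChange_of (fun T x y y' => ?_) (fun T x => ?_)
  · obtain ⟨a, b, rfl⟩ := exists_eq_lift x
    obtain ⟨c, d, rfl⟩ := exists_eq_lift y
    obtain ⟨c', d', rfl⟩ := exists_eq_lift y'
    simp [hf.lift_add, hg.lift_add]
  · obtain ⟨a, b, rfl⟩ := exists_eq_lift x
    rw [← lift_zero_zero, lift_tensor_put, hf.lift_zero, hg.lift_zero, lift_zero_zero]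

end Lens

/-! ### Additivity of the structural morphisms -/

theorem isAdditive_id (A : C) : IsAdditive (𝟙 A) := ⟨by simp, by simp⟩

theorem isAdditive_braiding (A B : C) : IsAdditive (β_ A B).hom where
  map_add x y := by
    obtain ⟨a, b, rfl⟩ := exists_eq_lift x
    obtain ⟨a', b', rfl⟩ := exists_eq_lift y
    simp
  map_zero {T} := by rw [← lift_zero_zero, lift_braiding_hom, lift_zero_zero]

theorem isAdditive_add (A : C) : IsAdditive (add A) where
  map_add x y := by
    obtain ⟨a, b, rfl⟩ := exists_eq_lift x
    obtain ⟨a', b', rfl⟩ := exists_eq_lift y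
    simp [add_add_add_comm]
  map_zero {T} := by rw [← lift_zero_zero, CartesianLeftAdditive.lift_add, _root_.add_zero]

theorem isAdditive_copy (A : C) : IsAdditive (lift (𝟙 A) (𝟙 A)) := ⟨by simp, by simp⟩

theorem isAdditive_zero (A : C) : IsAdditive (zero A) := ⟨by simp, by simp⟩

theorem isAdditive_toUnit (A : C) : IsAdditive (toUnit A) :=
  ⟨fun _ _ => toUnit_unique _ _, toUnit_unique _ _⟩

end

end CartesianLeftAdditive

/-! ### The lens of a term -/

namespace CLA.Presented

open CartesianLeftAdditive

variable {O : Type u} {S : List O → List O → Type v}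
  (E : ∀ ⦃a b : List O⦄, Term S a b → Term S a b → Prop)
  (R₀ : ∀ ⦃a b : List O⦄, S a b → Term S (a ++ b) a)

/-- The empty word is terminal, so `t` can only be discard, and the left unitor is an identity by
strictness. Reverse derivatives of linear generators are mostly prescribed in this form. -/
theorem hom_discard_tensor {a b c : List O} (t : Term S a []) (f : Term S b c) :
    hom E (.tensor t f) = snd (⟨a⟩ : Presented E) ⟨b⟩ ≫ hom E f := by
  have h : hom E t = toUnit (⟨a⟩ : Presented E) := toUnit_unique (C := Presented E) _ _
  have h' : (hom E t ⊗ₘ hom E f) ≫ (λ_ (⟨c⟩ : Presented E)).hom =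
      snd (⟨a⟩ : Presented E) ⟨b⟩ ≫ hom E f := by
    rw [h]
    refine hom_ext_lift fun T x y => ?_
    simp
  exact (Category.comp_id (hom E (.tensor t f))).symm.trans h'

theorem copyHom_eq (X : Presented E) : copyHom E X = lift (𝟙 X) (𝟙 X) := by
  rw [lift_eq, id_tensorHom_id, Category.comp_id]

theorem hom_discardW (a : List O) : hom E (.discardW a) = toUnit (⟨a⟩ : Presented E) :=
  toUnit_unique (C := Presented E) _ _

/-- The lens of a term: its morphism together with that of its reverse derivative. -/
def lens {a b : List O} (t : Term S a b) : Lens (⟨a⟩ : Presented E) ⟨b⟩ where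
  get := hom E t
  put := hom E (t.rev R₀)

theorem lens_id (a : List O) : lens E R₀ (.id a) = .lin (𝟙 _) (𝟙 _) :=
  Lens.ext rfl (hom_discard_tensor E _ _)

theorem lens_ofEq {a b : List O} (h : a = b) :
    lens E R₀ (.ofEq h) = .lin (hom E (.ofEq h)) (hom E (.ofEq h.symm)) := by
  subst h
  exact lens_id E R₀ a

/-- `rev` of a composite is the reverse chain rule with its copy and associator written out; on
pairs it evaluates to the `put` of the composite lens. -/
theorem lens_comp {a b c : List O} (f : Term S a b) (g : Term S b c) :
    lens E R₀ (.comp f g) = (lens E R₀ f).comp (lens E R₀ g) := by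
  refine Lens.ext rfl ?_
  change (copyHom E ⟨a⟩ ⊗ₘ 𝟙 (⟨c⟩ : Presented E)) ≫ (α_ _ _ _).hom ≫
    (𝟙 _ ⊗ₘ ((hom E f ⊗ₘ 𝟙 _) ≫ hom E (g.rev R₀))) ≫ hom E (f.rev R₀) = _
  rw [copyHom_eq]
  refine hom_ext_lift fun T x y => ?_
  rw [Lens.lift_comp_put]
  simp [lens]

theorem lens_tensor {a b a' b' : List O} (f : Term S a b) (g : Term S a' b') :
    lens E R₀ (.tensor f g) = (lens E R₀ f).tensor (lens E R₀ g) := by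
  refine Lens.ext rfl ?_
  change hom E (.mid a a' b b') ≫ (hom E (f.rev R₀) ⊗ₘ hom E (g.rev R₀)) = _
  rw [hom_mid]
  rfl

theorem lens_swap (a b : List O) :
    lens E R₀ (.swap a b) = .lin (β_ (⟨a⟩ : Presented E) ⟨b⟩).hom (β_ _ _).hom := by
  refine Lens.ext rfl ?_
  change hom E (.tensor (.discardW _) (.id _)) ≫ (β_ _ _).hom = _
  rw [hom_discard_tensor]
  exact congrArg (· ≫ (β_ (⟨b⟩ : Presented E) ⟨a⟩).hom) (Category.comp_id _)

/-! ### Transposes of linear terms -/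

variable {E R₀} in
/-- The lens of `t` is that of a linear morphism, whose transpose is represented by `t'`. -/
def HasTranspose {a b : List O} (t : Term S a b) (t' : Term S b a) : Prop :=
  lens E R₀ t = .lin (hom E t) (hom E t')

namespace HasTranspose

variable {E R₀}

theorem id (a : List O) : HasTranspose (E := E) (R₀ := R₀) (.id a) (.id a) := lens_id E R₀ a

theorem ofEq {a b : List O} (h : a = b) :
    HasTranspose (E := E) (R₀ := R₀) (.ofEq h) (.ofEq h.symm) := lens_ofEq E R₀ h

theorem swap (a b : List O) : HasTranspose (E := E) (R₀ := R₀) (.swap a b) (.swap b a) :=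
  lens_swap E R₀ a b

theorem comp {a b c : List O} {f : Term S a b} {f' : Term S b a} {g : Term S b c}
    {g' : Term S c b} (hf : HasTranspose (E := E) (R₀ := R₀) f f')
    (hg : HasTranspose (E := E) (R₀ := R₀) g g') :
    HasTranspose (E := E) (R₀ := R₀) (.comp f g) (.comp g' f') := by
  rw [HasTranspose, lens_comp, hf, hg, Lens.lin_comp_lin]
  rfl

theorem tensor {a b c d : List O} {f : Term S a b} {f' : Term S b a} {g : Term S c d}
    {g' : Term S d c} (hf : HasTranspose (E := E) (R₀ := R₀) f f')
    (hg : HasTranspose (E := E) (R₀ := R₀) g g') :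
    HasTranspose (E := E) (R₀ := R₀) (.tensor f g) (.tensor f' g') := by
  rw [HasTranspose, lens_tensor, hf, hg, Lens.lin_tensor_lin]
  rfl

theorem congr {a b : List O} {f : Term S a b} {f' f'' : Term S b a}
    (hf : HasTranspose (E := E) (R₀ := R₀) f f') (h : hom E f' = hom E f'') :
    HasTranspose (E := E) (R₀ := R₀) f f'' := by
  rw [HasTranspose, hf, h]

/-- A law between linear terms holds for lenses as soon as it and its transpose hold for morphisms.
-/
theorem lens_eq {a b : List O} {f g : Term S a b} {f' g' : Term S b a}
    (hf : HasTranspose (E := E) (R₀ := R₀) f f') (hg : HasTranspose (E := E) (R₀ := R₀) g g')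
    (h : Term.Rel E f g) (h' : hom E f' = hom E g') : lens E R₀ f = lens E R₀ g := by
  rw [hf, hg, hom_eq h, h']

/-- Transposition reverses the composite, so the result is `mid a c b d` up to bracketing. -/
theorem mid (a b c d : List O) :
    HasTranspose (E := E) (R₀ := R₀) (.mid a b c d) (.mid a c b d) :=
  ((ofEq _).comp (((id _).tensor ((swap _ _).tensor (id _))).comp (ofEq _))).congr
    (hom_eq (.comp_assoc _ _ _))

theorem copy (A : O) : HasTranspose (E := E) (R₀ := R₀) (.copy A) (.add A) :=
  Lens.ext rfl (hom_discard_tensor E (.discard A) (.add A))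

theorem discard (A : O) : HasTranspose (E := E) (R₀ := R₀) (.discard A) (.zero A) := by
  refine Lens.ext rfl ?_
  change hom E (.discard A) ≫ hom E (.zero A) =
    snd (⟨[A]⟩ : Presented E) (𝟙_ (Presented E)) ≫ hom E (.zero A)
  congr 1
  exact toUnit_unique (C := Presented E) _ _

theorem add (A : O) : HasTranspose (E := E) (R₀ := R₀) (.add A) (.copy A) :=
  Lens.ext rfl (hom_discard_tensor E (.discardW [A, A]) (.copy A))

theorem zero (A : O) : HasTranspose (E := E) (R₀ := R₀) (.zero A) (.discard A) :=
  Lens.ext rfl (toUnit_unique (C := Presented E) _ _)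

/-- The recursive clauses of `copyW` and `addW` are transposes of each other: `mid` is transposed
with its middle words exchanged, and copy on the first letter becomes addition. -/
theorem copyW : ∀ a : List O, HasTranspose (E := E) (R₀ := R₀) (.copyW a) (.addW a)
  | [] => id []
  | A :: a => ((copy A).tensor (copyW a)).comp (mid [A] [A] a a)

theorem addW : ∀ a : List O, HasTranspose (E := E) (R₀ := R₀) (.addW a) (.copyW a)
  | [] => id []
  | A :: a => (mid [A] a [A] a).comp ((add A).tensor (addW a))

theorem discardW : ∀ a : List O, HasTranspose (E := E) (R₀ := R₀) (.discardW a) (.zeroW a)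
  | [] => id []
  | A :: a => (discard A).tensor (discardW a)

theorem zeroW : ∀ a : List O, HasTranspose (E := E) (R₀ := R₀) (.zeroW a) (.discardW a)
  | [] => id []
  | A :: a => (zero A).tensor (zeroW a)

end HasTranspose

/-! ### Structural generators agree with the structure on one-letter words -/

theorem hom_copy (A : O) : hom E (.copy A) = lift (𝟙 (⟨[A]⟩ : Presented E)) (𝟙 _) := by
  have h := tensor_leftUnitor_inv_tensorμ (C := Presented E) (A := ⟨[A]⟩) (B := ⟨[A]⟩)
    (D := ⟨[A]⟩) (hom E (.copy A))
  rw [← hom_mid] at h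
  -- `copyW [A]` unfolds to the left side of `h`, and the unitors of these concrete words reduce to
  -- identities.
  have h' : copyHom E ⟨[A]⟩ = 𝟙 _ ≫ hom E (.copy A) ≫ (𝟙 (⟨[A]⟩ : Presented E) ⊗ₘ 𝟙 _) := h
  rw [← copyHom_eq, h', id_tensorHom_id, Category.id_comp]
  exact (Category.comp_id _).symm

theorem hom_add (A : O) : hom E (.add A) = CartesianLeftAdditive.add (⟨[A]⟩ : Presented E) := by
  have h := tensorμ_tensor_leftUnitor_hom (C := Presented E) (A := ⟨[A]⟩) (B := ⟨[A]⟩)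
    (D := ⟨[A]⟩) (hom E (.add A))
  rw [← hom_mid] at h
  have h' : CartesianLeftAdditive.add (⟨[A]⟩ : Presented E) =
    (𝟙 (⟨[A]⟩ : Presented E) ⊗ₘ 𝟙 _) ≫ hom E (.add A) ≫ 𝟙 _ := h
  rw [h', id_tensorHom_id, Category.comp_id]
  exact (Category.id_comp _).symm

theorem hom_zero (A : O) : hom E (.zero A) = CartesianLeftAdditive.zero (⟨[A]⟩ : Presented E) := by
  have h : (λ_ (𝟙_ (Presented E))).inv ≫ (hom E (.zero A) ⊗ₘ 𝟙 (𝟙_ _)) =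
      hom E (.zero A) ≫ (ρ_ (⟨[A]⟩ : Presented E)).inv := by
    rw [lift_rightUnitor_inv, ← Category.id_comp (λ_ (𝟙_ (Presented E))).inv,
      lift_leftUnitor_inv, lift_map, Category.comp_id]
    congr 1
    rw [toUnit_unit, Category.id_comp]
  have h' : 𝟙 _ ≫ CartesianLeftAdditive.zero (⟨[A]⟩ : Presented E) = hom E (.zero A) ≫ 𝟙 _ := h
  rw [Category.id_comp, Category.comp_id] at h'
  exact h'.symm

theorem hom_discard (A : O) : hom E (.discard A) = toUnit (⟨[A]⟩ : Presented E) :=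
  toUnit_unique (C := Presented E) _ _

/-! ### Invariance of the lens of a term under the laws -/

section

variable {E R₀}

/-- The lens of every term is additive in the change, if those of the generators are. -/
theorem additiveInChange_rev
    (additive_change : ∀ ⦃a b : List O⦄ (s : S a b),
      AdditiveInChange (A := (⟨a⟩ : Presented E)) (B := ⟨b⟩) (hom E ((Term.gen s).rev R₀)))
    {a b : List O} (t : Term S a b) :
    AdditiveInChange (A := (⟨a⟩ : Presented E)) (B := ⟨b⟩) (hom E (t.rev R₀)) := by
  change AdditiveInChange (lens E R₀ t).put
  -- The induction is on terms, because `R` is not yet known to descend: descent itself will need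
  -- this result.
  induction t with
  | gen s => exact additive_change s
  | id a => rw [lens_id]; exact Lens.additiveInChange_lin _ (isAdditive_id _)
  | swap a b => rw [lens_swap]; exact Lens.additiveInChange_lin _ (isAdditive_braiding _ _)
  | copy A => rw [HasTranspose.copy, hom_add]; exact Lens.additiveInChange_lin _ (isAdditive_add _)
  | discard A => rw [HasTranspose.discard, hom_zero]; exact Lens.additiveInChange_lin _ (isAdditive_zero _)
  | add A => rw [HasTranspose.add, hom_copy]; exact Lens.additiveInChange_lin _ (isAdditive_copy _)
  | zero A =>
    rw [HasTranspose.zero, hom_discard]; exact Lens.additiveInChange_lin _ (isAdditive_toUnit _)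
  | comp f g hf hg => rw [lens_comp]; exact Lens.additiveInChange_comp _ _ hf hg
  | tensor f g hf hg => rw [lens_tensor]; exact Lens.additiveInChange_tensor _ _ hf hg

/-- The lens of a term depends only on the morphism that the term represents. -/
theorem lens_eq_of_rel
    (well_defined : ∀ ⦃a b : List O⦄ (f g : Term S a b), E f g →
      hom E (f.rev R₀) = hom E (g.rev R₀))
    (additive_change : ∀ ⦃a b : List O⦄ (s : S a b),
      AdditiveInChange (A := (⟨a⟩ : Presented E)) (B := ⟨b⟩) (hom E ((Term.gen s).rev R₀)))
    {a b : List O} {f g : Term S a b} (h : Term.Rel E f g) :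
    lens E R₀ f = lens E R₀ g := by
  have copy_eq (a : List O) :
      lens E R₀ (.copyW a) = .lin (lift (𝟙 _) (𝟙 _)) (CartesianLeftAdditive.add (⟨a⟩ : Presented E)) := by
    rw [HasTranspose.copyW, ← copyHom_eq]
    rfl
  have discard_eq (a : List O) :
      lens E R₀ (.discardW a) = .lin (toUnit _) (CartesianLeftAdditive.zero (⟨a⟩ : Presented E)) := by
    rw [HasTranspose.discardW, hom_discardW]
    rfl
  induction h with
  | eqn h => exact Lens.ext (hom_eq (.eqn h)) (well_defined _ _ h)
  | refl f => rfl
  | symm _ ih => exact ih.symm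
  | trans _ _ ih ih' => exact ih.trans ih'
  | comp_congr _ _ ih ih' => rw [lens_comp, lens_comp, ih, ih']
  | tensor_congr _ _ ih ih' => rw [lens_tensor, lens_tensor, ih, ih']
  | id_comp f => rw [lens_comp, lens_id, Lens.id_comp]
  | comp_id f => rw [lens_comp, lens_id, Lens.comp_id]
  | comp_assoc f g h => simp only [lens_comp, Lens.comp_assoc]
  | tensor_id a b =>
    rw [lens_tensor, lens_id, lens_id, lens_id, Lens.lin_tensor_lin, id_tensorHom_id]
    rfl
  | tensor_comp f g f' g' => simp only [lens_comp, lens_tensor]; exact Lens.tensor_comp _ _ _ _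
  | tensor_assoc f g h =>
    simp only [lens_comp, lens_tensor, lens_ofEq]
    exact Lens.tensor_assoc _ _ _
  | @nil_tensor a b f =>
    rw [lens_tensor, lens_id]
    have h := Lens.unit_tensor (lens E R₀ f)
    -- Since `[] ++ a` reduces to `a`, the left unitors in `h` are identities by definition.
    have h' : Lens.comp (A := (⟨a⟩ : Presented E)) (((Lens.lin (𝟙 (𝟙_ _)) (𝟙 _)).tensor
      (lens E R₀ f))) (Lens.lin (𝟙 _) (𝟙 _)) = (Lens.lin (𝟙 _) (𝟙 _)).comp (lens E R₀ f) := h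
    rw [Lens.comp_id, Lens.id_comp] at h'
    exact h'
  | tensor_nil f =>
    simp only [lens_comp, lens_tensor, lens_ofEq, lens_id]
    exact Lens.tensor_unit _
  | swap_natural f g =>
    simp only [lens_comp, lens_tensor, lens_swap]
    exact Lens.braiding_natural _ _
  | swap_swap a b =>
    exact ((HasTranspose.swap a b).comp (.swap b a)).lens_eq (.id _) (.swap_swap a b)
      (hom_eq (.swap_swap a b))
  | hexagon a b c =>
    refine HasTranspose.lens_eq ((HasTranspose.ofEq _).comp ((HasTranspose.swap _ _).comp (.ofEq _)))
      (((HasTranspose.swap _ _).tensor (.id _)).comp ((HasTranspose.ofEq _).comp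
        ((HasTranspose.id _).tensor (.swap _ _)))) (.hexagon a b c) ?_
    -- The transposed hexagon: all composites reversed, every structural map inverted.
    change ((α_ (⟨b⟩ : Presented E) ⟨c⟩ ⟨a⟩).inv ≫ (β_ _ _).hom) ≫ (α_ _ _ _).inv =
      ((𝟙 _ ⊗ₘ (β_ _ _).hom) ≫ (α_ _ _ _).inv) ≫ ((β_ _ _).hom ⊗ₘ 𝟙 _)
    refine hom_ext_lift fun T x y => ?_
    obtain ⟨y, z, rfl⟩ := exists_eq_lift y
    simp
  -- Apart from the two naturality laws, each remaining comonoid law has the corresponding monoid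
  -- law as its transpose, and conversely.
  | copy_comm a =>
    exact ((HasTranspose.copyW a).comp (.swap a a)).lens_eq (.copyW a) (.copy_comm a)
      (hom_eq (.add_comm a))
  | copy_assoc a =>
    refine HasTranspose.lens_eq ((HasTranspose.copyW a).comp
      (((HasTranspose.copyW a).tensor (.id a)).comp (.ofEq _)))
      ((HasTranspose.copyW a).comp ((HasTranspose.id a).tensor (.copyW a))) (.copy_assoc a) ?_
    have h : hom E (.comp (.tensor (.addW a) (.id a)) (.addW a)) =
        (α_ (⟨a⟩ : Presented E) ⟨a⟩ ⟨a⟩).hom ≫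
          hom E (.comp (.tensor (.id a) (.addW a)) (.addW a)) := hom_eq (.add_assoc a)
    exact (hom_eq (.comp_assoc _ _ _)).trans ((Iso.inv_comp_eq _).2 h)
  | copy_counit a =>
    exact ((HasTranspose.copyW a).comp ((HasTranspose.discardW a).tensor (.id a))).lens_eq (.id a)
      (.copy_counit a) (hom_eq (.zero_add a))
  -- `f` is not linear here, so there is no transposed law; additivity of its reverse derivative
  -- takes that role.
  | copy_natural f =>
    simp only [lens_comp, lens_tensor, copy_eq]
    exact Lens.copy_natural _ (additiveInChange_rev additive_change f)
  | discard_natural f =>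
    simp only [lens_comp, discard_eq]
    exact Lens.discard_natural _ (additiveInChange_rev additive_change f)
  | copy_tensor a b =>
    exact (HasTranspose.copyW _).lens_eq
      (((HasTranspose.copyW a).tensor (.copyW b)).comp (.mid a a b b)) (.copy_tensor a b)
      (hom_eq (.add_tensor a b))
  | discard_tensor a b =>
    exact (HasTranspose.discardW _).lens_eq ((HasTranspose.discardW a).tensor (.discardW b))
      (.discard_tensor a b) (hom_eq (.zero_tensor a b))
  | add_comm a =>
    exact ((HasTranspose.swap a a).comp (.addW a)).lens_eq (.addW a) (.add_comm a)
      (hom_eq (.copy_comm a))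
  | add_assoc a =>
    refine HasTranspose.lens_eq (((HasTranspose.addW a).tensor (.id a)).comp (.addW a))
      ((HasTranspose.ofEq _).comp (((HasTranspose.id a).tensor (.addW a)).comp (.addW a)))
      (.add_assoc a) ?_
    have h : hom E (.copyW a) ≫ hom E (.tensor (.copyW a) (.id a)) ≫
        (α_ (⟨a⟩ : Presented E) ⟨a⟩ ⟨a⟩).hom =
          hom E (.comp (.copyW a) (.tensor (.id a) (.copyW a))) := hom_eq (.copy_assoc a)
    exact (Iso.eq_comp_inv _).2 ((Category.assoc _ _ _).trans h)
  | zero_add a =>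
    exact (((HasTranspose.zeroW a).tensor (.id a)).comp (.addW a)).lens_eq (.id a)
      (.zero_add a) (hom_eq (.copy_counit a))
  | add_tensor a b =>
    exact (HasTranspose.addW _).lens_eq ((HasTranspose.mid a b a b).comp
      ((HasTranspose.addW a).tensor (.addW b))) (.add_tensor a b) (hom_eq (.copy_tensor a b))
  | zero_tensor a b =>
    exact (HasTranspose.zeroW _).lens_eq ((HasTranspose.zeroW a).tensor (.zeroW b))
      (.zero_tensor a b) (hom_eq (.discard_tensor a b))

end

end CLA.Presented

/-! ### The forward derivative of a reverse differential combinator -/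

namespace CartesianLeftAdditive

/-- A reverse differential combinator that satisfies the structural axioms, on pairings, and
additivity in the change. -/
structure ReverseCombinator (C : Type u) [Category.{v} C] [CartesianMonoidalCategory C]
    [SymmetricCategory C] [CartesianLeftAdditive C] where
  /-- The reverse derivative of a morphism. -/
  R {A B : C} (f : A ⟶ B) : A ⊗ B ⟶ A
  R_id (A : C) : R (𝟙 A) = snd A A
  R_fst (A B : C) : R (fst A B) = snd (A ⊗ B) A ≫ lift (𝟙 A) 0
  R_snd (A B : C) : R (snd A B) = snd (A ⊗ B) B ≫ lift 0 (𝟙 B)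
  R_copy (A : C) : R (lift (𝟙 A) (𝟙 A)) = snd A (A ⊗ A) ≫ add A
  R_toUnit (A : C) : R (toUnit A) = 0
  R_add (A : C) : R (add A) = snd (A ⊗ A) A ≫ lift (𝟙 A) (𝟙 A)
  R_comp {A B D : C} (f : A ⟶ B) (g : B ⟶ D) :
    R (f ≫ g) = lift (fst A D) ((f ▷ D) ≫ R g) ≫ R f
  R_tensor {A B A' B' : C} (f : A ⟶ B) (g : A' ⟶ B') :
    R (f ⊗ₘ g) = tensorμ A A' B B' ≫ (R f ⊗ₘ R g)
  additive_change {A B : C} (f : A ⟶ B) : AdditiveInChange (R f)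

namespace ReverseCombinator

variable {C : Type u} [Category.{v} C] [CartesianMonoidalCategory C] [SymmetricCategory C]
  [CartesianLeftAdditive C] (ρ : ReverseCombinator C)

@[simp]
theorem lift_R_zero {A B T : C} (f : A ⟶ B) (x : T ⟶ A) : lift x 0 ≫ ρ.R f = 0 :=
  (ρ.additive_change f).lift_zero x

@[simp]
theorem lift_R_id {A T : C} (x y : T ⟶ A) : lift x y ≫ ρ.R (𝟙 A) = y := by
  simp [R_id]

@[simp]
theorem lift_R_fst {A B T : C} (x : T ⟶ A ⊗ B) (y : T ⟶ A) :
    lift x y ≫ ρ.R (fst A B) = lift y 0 := by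
  simp [R_fst]

@[simp]
theorem lift_R_snd {A B T : C} (x : T ⟶ A ⊗ B) (y : T ⟶ B) :
    lift x y ≫ ρ.R (snd A B) = lift 0 y := by
  simp [R_snd]

@[simp]
theorem lift_R_comp {A B D T : C} (f : A ⟶ B) (g : B ⟶ D) (x : T ⟶ A) (y : T ⟶ D) :
    lift x y ≫ ρ.R (f ≫ g) = lift x (lift (x ≫ f) y ≫ ρ.R g) ≫ ρ.R f := by
  simp [R_comp, comp_lift_assoc]

@[simp]
theorem lift_R_hom_zero {A B T : C} (x : T ⟶ A) (y : T ⟶ B) :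
    lift x y ≫ ρ.R (0 : A ⟶ B) = 0 := by
  rw [← toUnit_zero, lift_R_comp, R_toUnit, comp_hom_zero]

-- Write the pairing as copy followed by `f ⊗ₘ g`; the transpose of copy adds the two contributions.
@[simp]
theorem lift_R_lift {A B D T : C} (f : A ⟶ B) (g : A ⟶ D) (x : T ⟶ A) (y : T ⟶ B ⊗ D) :
    lift x y ≫ ρ.R (lift f g) = lift x (y ≫ fst B D) ≫ ρ.R f + lift x (y ≫ snd B D) ≫ ρ.R g := by
  have h : lift f g = lift (𝟙 A) (𝟙 A) ≫ (f ⊗ₘ g) := by simp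
  obtain ⟨b, d, rfl⟩ := exists_eq_lift y
  rw [h, lift_R_comp, R_tensor, R_copy]
  simp [lift_lift_tensorμ_assoc]

@[simp]
theorem lift_R_hom_add {A B T : C} (f g : A ⟶ B) (x : T ⟶ A) (y : T ⟶ B) :
    lift x y ≫ ρ.R (f + g) = lift x y ≫ ρ.R f + lift x y ≫ ρ.R g := by
  rw [← lift_add, lift_R_comp, R_add]
  simp

/-- An equation between morphisms, unlike its elementwise form, lets `R` or `D` be applied again to
the right side. -/
theorem R_comp_eq {A B D : C} (f : A ⟶ B) (g : B ⟶ D) :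
    ρ.R (f ≫ g) = lift (fst A D) (lift (fst A D ≫ f) (snd A D) ≫ ρ.R g) ≫ ρ.R f :=
  hom_ext_lift fun T x y => by simp [comp_lift_assoc]

theorem R_lift_eq {A B D : C} (f : A ⟶ B) (g : A ⟶ D) :
    ρ.R (lift f g) = lift (fst A (B ⊗ D)) (snd A (B ⊗ D) ≫ fst B D) ≫ ρ.R f +
      lift (fst A (B ⊗ D)) (snd A (B ⊗ D) ≫ snd B D) ≫ ρ.R g :=
  hom_ext_lift fun T x y => by simp [comp_lift_assoc]

theorem R_tensor_eq {A B A' B' : C} (f : A ⟶ B) (g : A' ⟶ B') :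
    ρ.R (f ⊗ₘ g) =
      lift (lift (fst _ _ ≫ fst _ _) (snd _ _ ≫ fst _ _) ≫ ρ.R f)
        (lift (fst _ _ ≫ snd _ _) (snd _ _ ≫ snd _ _) ≫ ρ.R g) := by
  refine hom_ext_lift fun T x y => ?_
  obtain ⟨a, a', rfl⟩ := exists_eq_lift x
  obtain ⟨b, b', rfl⟩ := exists_eq_lift y
  simp [R_tensor, lift_lift_tensorμ_assoc]

/-! ### Forward derivatives and transpose pairs -/

/-- The forward derivative. -/
def D {A B : C} (f : A ⟶ B) : A ⊗ A ⟶ B := forward (ρ.R (ρ.R f))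

theorem lift_D {A B T : C} (f : A ⟶ B) (x x' : T ⟶ A) :
    lift x x' ≫ ρ.D f = lift (lift x 0) x' ≫ ρ.R (ρ.R f) ≫ snd A B := by
  simp [D, forward, zeroHom_eq_zero]

@[simp]
theorem lift_D_zero {A B T : C} (f : A ⟶ B) (x : T ⟶ A) : lift x 0 ≫ ρ.D f = 0 := by
  rw [lift_D, ← Category.assoc, lift_R_zero, zero_comp_snd]

-- The forward derivative evaluates `R[R[f;g]]` at change `0`, and `R[g](f x, 0) = 0` keeps the base
-- point of `R[R[f]]` at `(x, 0)`. The second projection then retains only the contribution of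
-- `R[R[g]]`.
@[simp]
theorem lift_D_comp {A B D T : C} (f : A ⟶ B) (g : B ⟶ D) (x x' : T ⟶ A) :
    lift x x' ≫ ρ.D (f ≫ g) = lift (x ≫ f) (lift x x' ≫ ρ.D f) ≫ ρ.D g := by
  rw [lift_D, lift_D, lift_D, R_comp_eq, ← Category.assoc, lift_R_comp]
  simp [comp_lift_assoc]

@[simp]
theorem lift_D_lift {A B D T : C} (f : A ⟶ B) (g : A ⟶ D) (x x' : T ⟶ A) :
    lift x x' ≫ ρ.D (lift f g) = lift (lift x x' ≫ ρ.D f) (lift x x' ≫ ρ.D g) := by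
  rw [lift_D, lift_D, lift_D, R_lift_eq, ← Category.assoc, lift_R_hom_add]
  apply CartesianMonoidalCategory.hom_ext <;> simp

/-- Two morphisms that are linear and transposes of each other. -/
structure IsTransposePair {A B : C} (f : A ⟶ B) (f' : B ⟶ A) : Prop where
  R_left : ρ.R f = snd A B ≫ f'
  R_right : ρ.R f' = snd B A ≫ f

variable {ρ}

theorem IsTransposePair.symm {A B : C} {f : A ⟶ B} {f' : B ⟶ A} (h : ρ.IsTransposePair f f') :
    ρ.IsTransposePair f' f := ⟨h.R_right, h.R_left⟩

/-- Two reverse derivatives transpose twice: `R[f]` is `f'` on the change, and differentiating it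
returns `f`. Both halves of the pair are used. -/
theorem IsTransposePair.lift_D {A B T : C} {f : A ⟶ B} {f' : B ⟶ A}
    (h : ρ.IsTransposePair f f') (x x' : T ⟶ A) : lift x x' ≫ ρ.D f = x' ≫ f := by
  rw [ReverseCombinator.lift_D, h.R_left, ← Category.assoc, lift_R_comp, h.R_right]
  simp

variable (ρ)

theorem isTransposePair_fst (A B : C) : ρ.IsTransposePair (fst A B) (lift (𝟙 A) 0) :=
  ⟨ρ.R_fst A B, hom_ext_lift fun T x y => by simp⟩

theorem isTransposePair_snd (A B : C) : ρ.IsTransposePair (snd A B) (lift 0 (𝟙 B)) :=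
  ⟨ρ.R_snd A B, hom_ext_lift fun T x y => by simp⟩

@[simp]
theorem lift_D_fst {A B T : C} (x x' : T ⟶ A ⊗ B) :
    lift x x' ≫ ρ.D (fst A B) = x' ≫ fst A B := (ρ.isTransposePair_fst A B).lift_D x x'

@[simp]
theorem lift_D_snd {A B T : C} (x x' : T ⟶ A ⊗ B) :
    lift x x' ≫ ρ.D (snd A B) = x' ≫ snd A B := (ρ.isTransposePair_snd A B).lift_D x x'

/-! ### ARD.3 and ARD.4 and their closure properties -/

/-- Linearity of the reverse derivative of a morphism in the change. -/
def HasLinearChange {A B : C} (f : A ⟶ B) : Prop :=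
  ∀ ⦃T : C⦄ (x : T ⟶ A) (y y' : T ⟶ B),
    lift (lift x y) (lift 0 y') ≫ ρ.D (ρ.R f) = lift x y' ≫ ρ.R f

theorem hasLinearChange_iff {A B : C} (f : A ⟶ B) :
    ρ.HasLinearChange f ↔ LinearInChange (ρ.R f) (ρ.R (ρ.R (ρ.R f))) := by
  constructor
  · intro h
    refine hom_ext_lift fun T x y => ?_
    obtain ⟨y, y', rfl⟩ := exists_eq_lift y
    simpa [partialForward, comp_lift_assoc, zeroHom_eq_zero, D] using h x y y'
  · intro h T x y y'
    have h' := congrArg (lift x (lift y y') ≫ ·) h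
    simpa [partialForward, comp_lift_assoc, zeroHom_eq_zero, D] using h'

/-- Symmetry of the second forward derivative of a morphism. -/
def HasSymmetricPartials {A B : C} (f : A ⟶ B) : Prop :=
  ∀ ⦃T : C⦄ (a b c d : T ⟶ A),
    lift (lift a b) (lift c d) ≫ ρ.D (ρ.D f) = lift (lift a c) (lift b d) ≫ ρ.D (ρ.D f)

theorem hasSymmetricPartials_iff {A B : C} (f : A ⟶ B) :
    ρ.HasSymmetricPartials f ↔ SymmetricSecond (ρ.D (ρ.D f)) := by
  constructor
  · intro h
    refine hom_ext_lift fun T x y => ?_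
    obtain ⟨a, b, rfl⟩ := exists_eq_lift x
    obtain ⟨c, d, rfl⟩ := exists_eq_lift y
    rw [lift_lift_tensorμ_assoc, h]
  · intro h T a b c d
    have h' := congrArg (lift (lift a b) (lift c d) ≫ ·) h
    simpa only [lift_lift_tensorμ_assoc] using h'

variable {ρ}

theorem IsTransposePair.hasLinearChange {A B : C} {f : A ⟶ B} {f' : B ⟶ A}
    (h : ρ.IsTransposePair f f') : ρ.HasLinearChange f := by
  intro T x y y'
  rw [h.R_left, lift_D_comp, h.symm.lift_D]
  simp

/-- Differentiate `R[f](x, R[g](f x, y))` in `y` alone: as `D[f](x, 0) = 0`, the base points do not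
move, and the axiom applies to `R[g]` and then to `R[f]`. -/
theorem HasLinearChange.comp {A B D : C} {f : A ⟶ B} {g : B ⟶ D} (hf : ρ.HasLinearChange f)
    (hg : ρ.HasLinearChange g) : ρ.HasLinearChange (f ≫ g) := by
  intro T x y y'
  rw [R_comp_eq]
  simp [comp_lift_assoc, hf _ _ _, hg _ _ _]

theorem HasLinearChange.tensor {A B A' B' : C} {f : A ⟶ B} {g : A' ⟶ B'}
    (hf : ρ.HasLinearChange f) (hg : ρ.HasLinearChange g) : ρ.HasLinearChange (f ⊗ₘ g) := by
  intro T x y y'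
  rw [R_tensor_eq]
  -- The excluded simp lemmas would fold the pairing back into a tensor, hiding it from
  -- `lift_D_lift`.
  simp [-lift_fst_comp_snd_comp, -lift_snd_comp_fst_comp, comp_lift_assoc, hf _ _ _, hg _ _ _]

theorem IsTransposePair.hasSymmetricPartials {A B : C} {f : A ⟶ B} {f' : B ⟶ A}
    (h : ρ.IsTransposePair f f') : ρ.HasSymmetricPartials f := by
  have hD : ρ.D f = snd A A ≫ f := hom_ext_lift fun T x y => by simp [h.lift_D]
  intro T a b c d
  simp [hD]

/-- By the chain rule, `D[D[f;g]]((a,b),(c,d))` is `D[D[g]]` at `((f a, D[f](a,b)), (D[f](a,c),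
D[D[f]]((a,b),(c,d))))`. Symmetry for `g` exchanges the two middle entries, symmetry for `f` handles
the last. -/
theorem HasSymmetricPartials.comp {A B D : C} {f : A ⟶ B} {g : B ⟶ D}
    (hf : ρ.HasSymmetricPartials f) (hg : ρ.HasSymmetricPartials g) :
    ρ.HasSymmetricPartials (f ≫ g) := by
  have hD : ρ.D (f ≫ g) = lift (fst A A ≫ f) (ρ.D f) ≫ ρ.D g :=
    hom_ext_lift fun T x y => by simp [comp_lift_assoc]
  intro T a b c d
  simp only [hD, lift_D_comp, comp_lift, lift_fst_assoc, lift_D_lift, lift_D_fst, lift_fst]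
  rw [hg, hf]

theorem HasSymmetricPartials.lift {A B D : C} {f : A ⟶ B} {g : A ⟶ D}
    (hf : ρ.HasSymmetricPartials f) (hg : ρ.HasSymmetricPartials g) :
    ρ.HasSymmetricPartials (lift f g) := by
  have hD : ρ.D (CartesianMonoidalCategory.lift f g) =
      CartesianMonoidalCategory.lift (ρ.D f) (ρ.D g) := hom_ext_lift fun T x y => by simp
  intro T a b c d
  rw [hD, lift_D_lift, lift_D_lift, hf, hg]

theorem HasSymmetricPartials.tensor {A B A' B' : C} {f : A ⟶ B} {g : A' ⟶ B'}
    (hf : ρ.HasSymmetricPartials f) (hg : ρ.HasSymmetricPartials g) :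
    ρ.HasSymmetricPartials (f ⊗ₘ g) := by
  rw [← lift_fst_comp_snd_comp]
  exact ((ρ.isTransposePair_fst A A').hasSymmetricPartials.comp hf).lift
    ((ρ.isTransposePair_snd A A').hasSymmetricPartials.comp hg)

end ReverseCombinator

end CartesianLeftAdditive

/-! ### The reverse differential combinator of a presented category -/

namespace CLA.Presented

open CartesianLeftAdditive

variable {O : Type u} {S : List O → List O → Type v}
  {E : ∀ ⦃a b : List O⦄, Term S a b → Term S a b → Prop}
  {R₀ : ∀ ⦃a b : List O⦄, S a b → Term S (a ++ b) a}

/-- The operator on morphisms induced by the extension of `R₀` to terms. -/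
def reverse (h : ∀ ⦃a b : List O⦄ (f g : Term S a b), Term.Rel E f g →
      lens E R₀ f = lens E R₀ g) {X Y : Presented E} (f : X ⟶ Y) : X ⊗ Y ⟶ X :=
  Quotient.lift (s := setoid E X.word Y.word) (fun t => (lens E R₀ t).put)
    (fun _ _ r => congrArg Lens.put (h _ _ r)) f

/-! ### Structural axioms for the induced operator -/

section

variable (h : ∀ ⦃a b : List O⦄ (f g : Term S a b), Term.Rel E f g → lens E R₀ f = lens E R₀ g)

theorem reverse_of_hasTranspose {a b : List O} {t : Term S a b} {t' : Term S b a}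
    (ht : HasTranspose (E := E) (R₀ := R₀) t t') :
    reverse h (hom E t) = snd (⟨a⟩ : Presented E) ⟨b⟩ ≫ hom E t' :=
  congrArg Lens.put ht

theorem reverse_comp {X Y Z : Presented E} (f : X ⟶ Y) (g : Y ⟶ Z) :
    reverse h (f ≫ g) = lift (fst X Z) ((f ▷ Z) ≫ reverse h g) ≫ reverse h f := by
  obtain ⟨f, rfl⟩ := hom_surj E f
  obtain ⟨g, rfl⟩ := hom_surj E g
  exact congrArg Lens.put (lens_comp E R₀ f g)

theorem reverse_tensor {X Y X' Y' : Presented E} (f : X ⟶ Y) (g : X' ⟶ Y') :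
    reverse h (f ⊗ₘ g) = tensorμ X X' Y Y' ≫ (reverse h f ⊗ₘ reverse h g) := by
  obtain ⟨f, rfl⟩ := hom_surj E f
  obtain ⟨g, rfl⟩ := hom_surj E g
  exact congrArg Lens.put (lens_tensor E R₀ f g)

theorem reverse_id (X : Presented E) : reverse h (𝟙 X) = snd X X :=
  (reverse_of_hasTranspose h (.id X.word)).trans (Category.comp_id _)

theorem reverse_swap (X Y : Presented E) :
    reverse h (β_ X Y).hom = snd (X ⊗ Y) (Y ⊗ X) ≫ (β_ Y X).hom :=
  reverse_of_hasTranspose h (.swap X.word Y.word)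

theorem reverse_copy (X : Presented E) :
    reverse h (lift (𝟙 X) (𝟙 X)) = snd X (X ⊗ X) ≫ CartesianLeftAdditive.add X := by
  rw [← copyHom_eq]
  exact reverse_of_hasTranspose h (.copyW X.word)

theorem reverse_discard (X : Presented E) : reverse h (toUnit X) = zeroHom (X ⊗ 𝟙_ _) X := by
  rw [← hom_discardW E X.word]
  refine (reverse_of_hasTranspose h (.discardW X.word)).trans ?_
  exact congrArg (· ≫ CartesianLeftAdditive.zero X) (toUnit_unique (C := Presented E) _ _)

theorem reverse_add (X : Presented E) :
    reverse h (CartesianLeftAdditive.add X) = snd (X ⊗ X) X ≫ lift (𝟙 X) (𝟙 X) := by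
  rw [← copyHom_eq]
  exact reverse_of_hasTranspose h (.addW X.word)

theorem reverse_zero (X : Presented E) :
    reverse h (CartesianLeftAdditive.zero X) = toUnit (𝟙_ _ ⊗ X) :=
  toUnit_unique (C := Presented E) _ _

/-- The first projection is `id ⊗ discard` up to a unitor, so its transpose is `id ⊗ zero`, that is,
the pairing of the identity with `0`. -/
theorem reverse_fst (X Y : Presented E) :
    reverse h (fst X Y) = snd (X ⊗ Y) X ≫ lift (𝟙 X) 0 := by
  refine (reverse_of_hasTranspose h
    (((HasTranspose.id X.word).tensor (.discardW Y.word)).comp (.ofEq _))).trans ?_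
  have e : (ρ_ X).inv ≫ (𝟙 X ⊗ₘ CartesianLeftAdditive.zero Y) = lift (𝟙 X) 0 := by
    rw [← Category.id_comp (ρ_ X).inv, lift_rightUnitor_inv, lift_map, Category.comp_id,
      toUnit_zero]
  rw [← e]
  rfl

theorem reverse_snd (X Y : Presented E) :
    reverse h (snd X Y) = snd (X ⊗ Y) Y ≫ lift 0 (𝟙 Y) := by
  refine (reverse_of_hasTranspose h
    (((HasTranspose.discardW X.word).tensor (.id Y.word)).comp (.ofEq _))).trans ?_
  have e : (λ_ Y).inv ≫ (CartesianLeftAdditive.zero X ⊗ₘ 𝟙 Y) = lift 0 (𝟙 Y) := by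
    rw [← Category.id_comp (λ_ Y).inv, lift_leftUnitor_inv, lift_map, Category.comp_id,
      toUnit_zero]
  rw [← e]
  rfl

/-- The reverse differential combinator of the presented category. -/
def reverseCombinator (additive_change : ∀ ⦃a b : List O⦄ (s : S a b),
      AdditiveInChange (A := (⟨a⟩ : Presented E)) (B := ⟨b⟩) (hom E ((Term.gen s).rev R₀))) :
    ReverseCombinator (Presented E) where
  R := reverse h
  R_id := reverse_id h
  R_fst := reverse_fst h
  R_snd := reverse_snd h
  R_copy := reverse_copy h
  R_toUnit := reverse_discard h
  R_add := reverse_add h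
  R_comp := reverse_comp h
  R_tensor := reverse_tensor h
  additive_change f := by
    obtain ⟨f, rfl⟩ := hom_surj E f
    exact additiveInChange_rev additive_change f

variable (additive_change : ∀ ⦃a b : List O⦄ (s : S a b),
  AdditiveInChange (A := (⟨a⟩ : Presented E)) (B := ⟨b⟩) (hom E ((Term.gen s).rev R₀)))

theorem isTransposePair_of_hasTranspose {a b : List O} {t : Term S a b} {t' : Term S b a}
    (ht : HasTranspose (E := E) (R₀ := R₀) t t') (ht' : HasTranspose (E := E) (R₀ := R₀) t' t) :
    (reverseCombinator h additive_change).IsTransposePair (hom E t) (hom E t') :=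
  ⟨reverse_of_hasTranspose h ht, reverse_of_hasTranspose h ht'⟩

/-- Hypothesis ARD.4 on generators concerns `D` computed on terms; this carries it over to `D` on
morphisms. -/
theorem hom_fwd {a b : List O} (t : Term S a b) :
    hom E (t.fwd R₀) = (reverseCombinator h additive_change).D (hom E t) := by
  have e : hom E (.comp (.ofEq (List.append_nil a).symm) (.tensor (.id a) (.zeroW b))) =
      lift (𝟙 (⟨a⟩ : Presented E)) (zeroHom _ ⟨b⟩) := by
    change (ρ_ (⟨a⟩ : Presented E)).inv ≫
      (𝟙 (⟨a⟩ : Presented E) ⊗ₘ CartesianLeftAdditive.zero (⟨b⟩ : Presented E)) = _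
    rw [← Category.id_comp (ρ_ _).inv, lift_rightUnitor_inv, lift_map, Category.comp_id]
    rfl
  change (hom E (.comp (.ofEq (List.append_nil a).symm) (.tensor (.id a) (.zeroW b))) ⊗ₘ
    𝟙 (⟨a⟩ : Presented E)) ≫ hom E ((t.rev R₀).rev R₀) ≫ hom E (.tensor (.discardW a) (.id b)) = _
  rw [e, hom_discard_tensor, tensorHom_id]
  exact congrArg (_ ≫ _ ≫ ·) (Category.comp_id _)

/-- A property of morphisms that holds for the generators and the linear structural morphisms, and
that is closed under composition and tensor, holds for all terms. -/
theorem hom_induction {P : ∀ {X Y : Presented E}, (X ⟶ Y) → Prop}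
    (gen : ∀ ⦃a b : List O⦄ (s : S a b), P (hom E (.gen s)))
    (pair : ∀ {X Y : Presented E} (f : X ⟶ Y) (f' : Y ⟶ X),
      (reverseCombinator h additive_change).IsTransposePair f f' → P f)
    (comp : ∀ {X Y Z : Presented E} (f : X ⟶ Y) (g : Y ⟶ Z), P f → P g → P (f ≫ g))
    (tensor : ∀ {X Y X' Y' : Presented E} (f : X ⟶ Y) (g : X' ⟶ Y'), P f → P g → P (f ⊗ₘ g))
    {X Y : Presented E} (f : X ⟶ Y) : P f := by
  have key {a b : List O} (t : Term S a b) : P (hom E t) := by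
    induction t with
    | gen s => exact gen s
    | id a => exact pair _ _ (isTransposePair_of_hasTranspose h additive_change (.id a) (.id a))
    | swap a b =>
      exact pair _ _ (isTransposePair_of_hasTranspose h additive_change (.swap a b) (.swap b a))
    | copy A =>
      exact pair _ _ (isTransposePair_of_hasTranspose h additive_change (.copy A) (.add A))
    | discard A =>
      exact pair _ _ (isTransposePair_of_hasTranspose h additive_change (.discard A) (.zero A))
    | add A =>
      exact pair _ _ (isTransposePair_of_hasTranspose h additive_change (.add A) (.copy A))
    | zero A =>
      exact pair _ _ (isTransposePair_of_hasTranspose h additive_change (.zero A) (.discard A))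
    | comp f g hf hg => exact comp _ _ hf hg
    | tensor f g hf hg => exact tensor _ _ hf hg
  obtain ⟨t, rfl⟩ := hom_surj E f
  exact key t

end

end CLA.Presented

open CLA CartesianLeftAdditive in
theorem theorem2 {O : Type u} (S : List O → List O → Type v)
    (E : ∀ ⦃a b : List O⦄, Term S a b → Term S a b → Prop)
    (R₀ : ∀ ⦃a b : List O⦄, S a b → Term S (a ++ b) a)
    (well_defined : ∀ ⦃a b : List O⦄ (f g : Term S a b), E f g →
      Presented.hom E (f.rev R₀) = Presented.hom E (g.rev R₀))
    (additive_change : ∀ ⦃a b : List O⦄ (s : S a b),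
      AdditiveInChange (A := (⟨a⟩ : Presented E)) (B := ⟨b⟩)
        (Presented.hom E ((Term.gen s).rev R₀)))
    (linear_change : ∀ ⦃a b : List O⦄ (s : S a b),
      LinearInChange (A := (⟨a⟩ : Presented E)) (B := ⟨b⟩)
        (Presented.hom E ((Term.gen s).rev R₀))
        (Presented.hom E ((((Term.gen s).rev R₀).rev R₀).rev R₀)))
    (symmetric_partials : ∀ ⦃a b : List O⦄ (s : S a b),
      SymmetricSecond (A := (⟨a⟩ : Presented E)) (B := ⟨b⟩)
        (Presented.hom E (((Term.gen s).fwd R₀).fwd R₀))) :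
    ∃ r : ReverseDerivativeCategory (Presented E),
      ∀ ⦃a b : List O⦄ (t : Term S a b),
        r.R (Presented.hom E t) = Presented.hom E (t.rev R₀) := by
  have h ⦃a b : List O⦄ (f g : Term S a b) (hfg : Term.Rel E f g) :
      Presented.lens E R₀ f = Presented.lens E R₀ g :=
    Presented.lens_eq_of_rel well_defined additive_change hfg
  let ρ := Presented.reverseCombinator h additive_change
  have linear {X Y : Presented E} (f : X ⟶ Y) : ρ.HasLinearChange f := by
    refine Presented.hom_induction h additive_change (P := fun f => ρ.HasLinearChange f)
      (fun a b s => ?_) (fun f f' hf => hf.hasLinearChange) (fun f g hf hg => hf.comp hg)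
      (fun f g hf hg => hf.tensor hg) f
    -- On the class of a term, `ρ.R` computes to the class of its `rev`, so the hypothesis on terms
    -- fits by definition.
    exact (ρ.hasLinearChange_iff _).2 (linear_change s)
  have symmetric {X Y : Presented E} (f : X ⟶ Y) : ρ.HasSymmetricPartials f := by
    refine Presented.hom_induction h additive_change (P := fun f => ρ.HasSymmetricPartials f)
      (fun a b s => ?_) (fun f f' hf => hf.hasSymmetricPartials) (fun f g hf hg => hf.comp hg)
      (fun f g hf hg => hf.tensor hg) f
    refine (ρ.hasSymmetricPartials_iff _).2 ?_
    have hs := symmetric_partials s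
    rw [Presented.hom_fwd h additive_change, Presented.hom_fwd h additive_change] at hs
    exact hs
  exact ⟨{
    R := ρ.R
    R_id := ρ.R_id
    R_swap := Presented.reverse_swap h
    R_copy := ρ.R_copy
    R_discard := ρ.R_toUnit
    R_add := ρ.R_add
    R_zero := Presented.reverse_zero h
    R_comp := ρ.R_comp
    R_tensor := ρ.R_tensor
    additive_change := ρ.additive_change
    linear_change := fun f => (ρ.hasLinearChange_iff f).1 (linear f)
    symmetric_partials := fun f => (ρ.hasSymmetricPartials_iff f).1 (symmetric f) },
    fun _ _ _ => rfl⟩
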